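/- Let $\mathbb F$ be a field of characteristic zero. Points of the phase space $\mathbb F^4$ are written $(\boldsymbol x,\boldsymbol X)=(x_1,x_2,X_1,X_2)$, and parameters are $p=(c_1,c_2,a_1,a_2,a_3)$, $q=(d_1,d_2,b_1,b_2,b_3)\in\mathbb F^5$ with all $a_i,b_i$ nonzero. Let $$R_{p,q}:\big((x_1,x_2,X_1,X_2),(y_1,y_2,Y_1,Y_2)\big)\mapsto\big((u_1,u_2,U_1,U_2),(v_1,v_2,V_1,V_2)\big)$$ be given by $$(u_1,u_2)=\tfrac{b_3}{a_3}(y_1,y_2)+\tfrac{b_3}{a_3}\tfrac{C_1}{D_1}\big(\tfrac{a_3}{b_1}x_1-y_1,\ \tfrac{a_3}{b_2}x_2-y_2\big),$$ $$(v_1,v_2)=\big(\tfrac{a_1}{b_1}x_1,\tfrac{a_2}{b_2}x_2\big)-b_1\tfrac{C_2}{D_2}\big(a_1(\tfrac{a_3}{b_1}x_1-y_1),\ a_2(\tfrac{a_3}{b_2}x_2-y_2)\big),$$ $$U_i=\frac{(a_ix_i-b_iv_i)X_i+(a_iy_i-a_3v_i)Y_i}{a_iu_i-b_3v_i},\qquad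 V_i=\frac{(b_iu_i-b_3x_i)X_i+(a_3u_i-b_3y_i)Y_i}{a_iu_i-b_3v_i}\qquad(i=1,2),$$ where $$C_1=a_2a_3b_1(d_1-2d_2)-b_1b_2b_3(c_1-2c_2),\qquad C_2=\tfrac{b_2b_3}{a_3}(c_1+c_2)-a_2(d_1+d_2),$$ $$D_1=a_2a_3b_2b_3(a_3x_1-b_1y_1)Y_1+a_2a_3b_1b_3(a_3x_2-b_2y_2)Y_2+C_1+3a_2a_3b_1d_2,$$ $$D_2=a_2b_1b_2b_3(a_3x_1-b_1y_1)X_1+a_2b_1b_2b_3(a_3x_2-b_2y_2)X_2-C_1-3a_2a_3b_1d_2.$$ The map is regarded as defined where $D_1$, $D_2$, $a_1u_1-b_3v_1$ and $a_2u_2-b_3v_2$ are nonzero. Let $L(\boldsymbol x,\boldsymbol X,p,\lambda)$ be the matrix $$\begin{pmatrix}\frac{a_1(c_1+c_2)}{a_2a_3}-a_1x_1X_1-\lambda a_1&-a_2x_2X_1&X_1\\-a_1x_1X_2&\frac{c_1+c_2}{a_3}-a_2x_2X_2-\lambda a_2&X_2\\ \frac{3a_1c_2x_1}{a_2}-a_1a_3x_1S&3c_2x_2-a_2a_3x_2S&\frac{c_1-2c_2}{a_2}+a_3S-\lambda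 a_3\end{pmatrix},\quad S=x_1X_1+x_2X_2.$$ Then, for all such parameters $p,q,r$: 1. $R$ is a parametric birational Yang–Baxter map: $R_{p,q}$ is a birational map of $\mathbb F^4\times\mathbb F^4$ to itself, and $$R^{12}_{p,q}\circ R^{13}_{p,r}\circ R^{23}_{q,r}=R^{23}_{q,r}\circ R^{13}_{p,r}\circ R^{12}_{p,q}$$ wherever both sides are defined, which is the case on a nonempty Zariski open subset of $(\mathbb F^4)^3$. If moreover neither of $\frac{c_1+c_2}{a_2a_3},\frac{c_1-2c_2}{a_2a_3}$ (the roots of $\det L(\boldsymbol x,\boldsymbol X,p,\lambda)$ in $\lambda$) equals either of $\frac{d_1+d_2}{b_2b_3},\frac{d_1-2d_2}{b_2b_3}$, then $R_{p,q}$ is quadrirational: for every fixed $(\boldsymbol y,\boldsymbol Y)$ the map $(\boldsymbol x,\boldsymbol X)\mapsto(\boldsymbol u,\boldsymbol U)$, and for every fixed $(\boldsymbol x,\boldsymbol X)$ the map $(\boldsymbol y,\boldsymbol Y)\mapsto(\boldsymbol v,\boldsymbol V)$, is a birational map of $\mathbb F^4$ to itself. 2. $L$ is a strong Lax matrix of $R_{p,q}$: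 wherever $R_{p,q}$ is defined, its value satisfies $$L(\boldsymbol u,\boldsymbol U,p,\lambda)L(\boldsymbol v,\boldsymbol V,q,\lambda)=L(\boldsymbol y,\boldsymbol Y,q,\lambda)L(\boldsymbol x,\boldsymbol X,p,\lambda)\quad\text{for all }\lambda\in\mathbb F,$$ and, if $(c_2,\boldsymbol X)\neq(0,0)$ and $(d_2,\boldsymbol Y)\ne(0,0)$, it is the only $\big((\boldsymbol u,\boldsymbol U),(\boldsymbol v,\boldsymbol V)\big)\in\mathbb F^4\times\mathbb F^4$ that does. 3. $R_{p,q}$ is symplectic with respect to $\omega=dx_1\wedge dX_1+dx_2\wedge dX_2+dy_1\wedge dY_1+dy_2\wedge dY_2$: as rational differential forms, $$du_1\wedge dU_1+du_2\wedge dU_2+dv_1\wedge dV_1+dv_2\wedge dV_2=\omega .$$ -/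

import Mathlib

open scoped KaehlerDifferential

noncomputable section

namespace YangBaxter

/-! ### Rational maps between affine spaces, through their rational points -/

/-- A property of points of the affine space `σ → F` holds generically if it holds on a nonempty
principal Zariski open set. -/
def Generically {F σ : Type*} [Field F] (S : Set (σ → F)) : Prop :=
  ∃ Q : MvPolynomial σ F, Q ≠ 0 ∧ ∀ z, MvPolynomial.eval z Q ≠ 0 → z ∈ S

/-- On the principal open set `Q ≠ 0`, every coordinate of `f` is a quotient of two polynomials
whose denominator has no zero there. -/
def IsRationalOn {F σ τ : Type*} [Field F] (Q : MvPolynomial σ F) (f : (σ → F) → (τ → F)) : Prop :=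
  ∀ j, ∃ N D : MvPolynomial σ F, ∀ z, MvPolynomial.eval z Q ≠ 0 →
    MvPolynomial.eval z D ≠ 0 ∧ f z j = MvPolynomial.eval z N / MvPolynomial.eval z D

/-- The map `f`, which is meaningful on the set `dom`, is a birational isomorphism: it restricts to
a bijection between two nonempty principal open sets, the first one inside `dom`, and both this
bijection and its inverse are given by rational functions. -/
def IsBirational {F σ τ : Type*} [Field F] (dom : Set (σ → F)) (f : (σ → F) → (τ → F)) : Prop :=
  ∃ (Q : MvPolynomial σ F) (Q' : MvPolynomial τ F) (g : (τ → F) → (σ → F)),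
    Q ≠ 0 ∧ Q' ≠ 0 ∧
    (∀ z, MvPolynomial.eval z Q ≠ 0 → z ∈ dom) ∧
    IsRationalOn Q f ∧ IsRationalOn Q' g ∧
    (∀ z, MvPolynomial.eval z Q ≠ 0 → MvPolynomial.eval (f z) Q' ≠ 0 ∧ g (f z) = z) ∧
    (∀ w, MvPolynomial.eval w Q' ≠ 0 → MvPolynomial.eval (g w) Q ≠ 0 ∧ f (g w) = w)

/-- A partially defined map `R : (x, y) ↦ (u, v)` is birational, as a map of the affine space with
the coordinates of `x` and `y`. -/
def IsBirationalPair {F σ : Type*} [Field F] (dom : Set ((σ → F) × (σ → F)))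
    (R : (σ → F) × (σ → F) → (σ → F) × (σ → F)) : Prop :=
  IsBirational {w : σ ⊕ σ → F | (w ∘ Sum.inl, w ∘ Sum.inr) ∈ dom}
    (fun w => Sum.elim (R (w ∘ Sum.inl, w ∘ Sum.inr)).1 (R (w ∘ Sum.inl, w ∘ Sum.inr)).2)

/-- A partially defined map `R : (x, y) ↦ (u, v)` is quadrirational: `R` is birational, the map
`x ↦ u(x, y)` is birational for each fixed `y`, and the map `y ↦ v(x, y)` is birational for each
fixed `x`. -/
def IsQuadrirational {F σ : Type*} [Field F] (dom : Set ((σ → F) × (σ → F)))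
    (R : (σ → F) × (σ → F) → (σ → F) × (σ → F)) : Prop :=
  IsBirationalPair dom R ∧
    (∀ y, IsBirational {x | (x, y) ∈ dom} (fun x => (R (x, y)).1)) ∧
    (∀ x, IsBirational {y | (x, y) ∈ dom} (fun y => (R (x, y)).2))

/-! ### The Yang-Baxter equation for partially defined maps -/

/-- `R` acting on the factors 1 and 2 of `X × X × X`. -/
def act12 {X : Type*} (R : X × X → X × X) (w : X × X × X) : X × X × X :=
  ((R (w.1, w.2.1)).1, (R (w.1, w.2.1)).2, w.2.2)

/-- `R` acting on the factors 1 and 3 of `X × X × X`. -/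
def act13 {X : Type*} (R : X × X → X × X) (w : X × X × X) : X × X × X :=
  ((R (w.1, w.2.2)).1, w.2.1, (R (w.1, w.2.2)).2)

/-- `R` acting on the factors 2 and 3 of `X × X × X`. -/
def act23 {X : Type*} (R : X × X → X × X) (w : X × X × X) : X × X × X :=
  (w.1, (R (w.2.1, w.2.2)).1, (R (w.2.1, w.2.2)).2)

/-- The triples at which `R¹²_{p,q} ∘ R¹³_{p,r} ∘ R²³_{q,r}` and
`R²³_{q,r} ∘ R¹³_{p,r} ∘ R¹²_{p,q}` are both defined, `dom p q` being the domain of `R p q`. -/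
def tripleDomain {X P : Type*} (dom : P → P → Set (X × X)) (R : P → P → X × X → X × X)
    (p q r : P) : Set (X × X × X) :=
  {w | (w.2.1, w.2.2) ∈ dom q r ∧
    ((act23 (R q r) w).1, (act23 (R q r) w).2.2) ∈ dom p r ∧
    ((act13 (R p r) (act23 (R q r) w)).1, (act13 (R p r) (act23 (R q r) w)).2.1) ∈ dom p q ∧
    (w.1, w.2.1) ∈ dom p q ∧
    ((act12 (R p q) w).1, (act12 (R p q) w).2.2) ∈ dom p r ∧
    (act13 (R p r) (act12 (R p q) w)).2 ∈ dom q r}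

/-- The parametric Yang-Baxter equation for a family of partially defined maps `R p q`, with
parameters in `params`: both sides are defined generically, and they agree wherever both are defined. -/
def IsParametricYangBaxter {F σ P : Type*} [Field F] (params : Set P)
    (dom : P → P → Set ((σ → F) × (σ → F)))
    (R : P → P → (σ → F) × (σ → F) → (σ → F) × (σ → F)) : Prop :=
  ∀ p ∈ params, ∀ q ∈ params, ∀ r ∈ params,
    Generically {z : σ ⊕ σ ⊕ σ → F |
      (z ∘ Sum.inl, z ∘ Sum.inr ∘ Sum.inl, z ∘ Sum.inr ∘ Sum.inr) ∈ tripleDomain dom R p q r} ∧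
    ∀ w ∈ tripleDomain dom R p q r,
      act12 (R p q) (act13 (R p r) (act23 (R q r) w)) =
        act23 (R q r) (act13 (R p r) (act12 (R p q) w))

/-! ### The map -/

/-- The parameters `p = (c₁, c₂, a₁, a₂, a₃)`. For a second set of parameters
`q = (d₁, d₂, b₁, b₂, b₃)` one has `d₁ = q.c1`, …, `b₃ = q.a3`. -/
structure Params (K : Type*) where
  c1 : K
  c2 : K
  a1 : K
  a2 : K
  a3 : K

/-- The parameters with `a₁, a₂, a₃` nonzero, that is, with `diag(a₁, a₂, a₃)` invertible. -/
def admissible (K : Type*) [Field K] : Set (Params K) :=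
  {p | p.a1 ≠ 0 ∧ p.a2 ≠ 0 ∧ p.a3 ≠ 0}

/-- Extension of scalars for parameters. -/
def Params.map {F K : Type*} (f : F → K) (p : Params F) : Params K :=
  ⟨f p.c1, f p.c2, f p.a1, f p.a2, f p.a3⟩

/-- A point of the four-dimensional phase space, with coordinates
`x 0 = x₁`, `x 1 = x₂`, `x 2 = X₁`, `x 3 = X₂`. -/
abbrev Pt (K : Type*) := Fin 4 → K

/-- The reduced `3 × 3` Lax matrix `L(x, X, p, λ)`. -/
def lax {K : Type*} [Field K] (x : Pt K) (p : Params K) (lam : K) : Matrix (Fin 3) (Fin 3) K :=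
  !![p.a1 * (p.c1 + p.c2) / (p.a2 * p.a3) - p.a1 * x 0 * x 2 - lam * p.a1,
      -(p.a2 * x 1 * x 2),
      x 2;
    -(p.a1 * x 0 * x 3),
      (p.c1 + p.c2) / p.a3 - p.a2 * x 1 * x 3 - lam * p.a2,
      x 3;
    3 * p.a1 * p.c2 * x 0 / p.a2 - p.a1 * p.a3 * x 0 * (x 0 * x 2 + x 1 * x 3),
      3 * p.c2 * x 1 - p.a2 * p.a3 * x 1 * (x 0 * x 2 + x 1 * x 3),
      (p.c1 - 2 * p.c2) / p.a2 + p.a3 * (x 0 * x 2 + x 1 * x 3) - lam * p.a3]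

section Formulas

variable {K : Type*} [Field K] (p q : Params K) (x y : Pt K)

def C1 : K :=
  p.a2 * p.a3 * q.a1 * (q.c1 - 2 * q.c2) - q.a1 * q.a2 * q.a3 * (p.c1 - 2 * p.c2)

def C2 : K :=
  q.a2 * q.a3 / p.a3 * (p.c1 + p.c2) - p.a2 * (q.c1 + q.c2)

def D1 : K :=
  p.a2 * p.a3 * q.a2 * q.a3 * (p.a3 * x 0 - q.a1 * y 0) * y 2 +
    p.a2 * p.a3 * q.a1 * q.a3 * (p.a3 * x 1 - q.a2 * y 1) * y 3 +
    C1 p q + 3 * p.a2 * p.a3 * q.a1 * q.c2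

def D2 : K :=
  p.a2 * q.a1 * q.a2 * q.a3 * (p.a3 * x 0 - q.a1 * y 0) * x 2 +
    p.a2 * q.a1 * q.a2 * q.a3 * (p.a3 * x 1 - q.a2 * y 1) * x 3 -
    C1 p q - 3 * p.a2 * p.a3 * q.a1 * q.c2

def u1 : K :=
  q.a3 / p.a3 * y 0 + q.a3 / p.a3 * (C1 p q / D1 p q x y) * (p.a3 / q.a1 * x 0 - y 0)

def u2 : K :=
  q.a3 / p.a3 * y 1 + q.a3 / p.a3 * (C1 p q / D1 p q x y) * (p.a3 / q.a2 * x 1 - y 1)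

def v1 : K :=
  p.a1 / q.a1 * x 0 - q.a1 * (C2 p q / D2 p q x y) * (p.a1 * (p.a3 / q.a1 * x 0 - y 0))

def v2 : K :=
  p.a2 / q.a2 * x 1 - q.a1 * (C2 p q / D2 p q x y) * (p.a2 * (p.a3 / q.a2 * x 1 - y 1))

/-- The common denominator of `U₁` and `V₁`. -/
def E1 : K := p.a1 * u1 p q x y - q.a3 * v1 p q x y

/-- The common denominator of `U₂` and `V₂`. -/
def E2 : K := p.a2 * u2 p q x y - q.a3 * v2 p q x y

def U1 : K :=
  ((p.a1 * x 0 - q.a1 * v1 p q x y) * x 2 + (p.a1 * y 0 - p.a3 * v1 p q x y) * y 2) / E1 p q x y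

def U2 : K :=
  ((p.a2 * x 1 - q.a2 * v2 p q x y) * x 3 + (p.a2 * y 1 - p.a3 * v2 p q x y) * y 3) / E2 p q x y

def V1 : K :=
  ((q.a1 * u1 p q x y - q.a3 * x 0) * x 2 + (p.a3 * u1 p q x y - q.a3 * y 0) * y 2) / E1 p q x y

def V2 : K :=
  ((q.a2 * u2 p q x y - q.a3 * x 1) * x 3 + (p.a3 * u2 p q x y - q.a3 * y 1) * y 3) / E2 p q x y

end Formulas

/-- The map `R_{p,q} : ((x, X), (y, Y)) ↦ ((u, U), (v, V))`. -/
def ybMap {K : Type*} [Field K] (p q : Params K) (w : Pt K × Pt K) : Pt K × Pt K :=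
  (![u1 p q w.1 w.2, u2 p q w.1 w.2, U1 p q w.1 w.2, U2 p q w.1 w.2],
    ![v1 p q w.1 w.2, v2 p q w.1 w.2, V1 p q w.1 w.2, V2 p q w.1 w.2])

/-- The points at which no denominator in the formulas for `R_{p,q}` vanishes. -/
def ybDomain {K : Type*} [Field K] (p q : Params K) : Set (Pt K × Pt K) :=
  {w | D1 p q w.1 w.2 ≠ 0 ∧ D2 p q w.1 w.2 ≠ 0 ∧ E1 p q w.1 w.2 ≠ 0 ∧ E2 p q w.1 w.2 ≠ 0}

/-! ### The three properties -/

/-- The refactorisation problem `L(u, U, p, λ) L(v, V, q, λ) = L(y, Y, q, λ) L(x, X, p, λ)`,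
for all values of the spectral parameter `λ`. -/
def Refactors {F : Type*} [Field F] (p q : Params F) (x y u v : Pt F) : Prop :=
  ∀ lam : F, lax u p lam * lax v q lam = lax y q lam * lax x p lam

/-- The Lax matrix `L(x, X, p, λ)` is not a scalar multiple of `diag(a₁, a₂, a₃)`; the only
exception is `c₂ = 0` and `X = 0`, where `L` does not depend on `x`. -/
def Nonscalar {F : Type*} [Field F] (p : Params F) (x : Pt F) : Prop :=
  p.c2 ≠ 0 ∨ x 2 ≠ 0 ∨ x 3 ≠ 0

/-- `L` is a strong Lax matrix of `R_{p,q}`: wherever `R_{p,q}` is defined its value solves the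
refactorisation problem, and if `L(x, X, p, ·)` and `L(y, Y, q, ·)` are not scalar multiples of
the diagonal matrices of the parameters, then it is the only solution. -/
def IsStrongLax {F : Type*} [Field F] (p q : Params F) : Prop :=
  ∀ x y : Pt F, (x, y) ∈ ybDomain p q →
    Refactors p q x y (ybMap p q (x, y)).1 (ybMap p q (x, y)).2 ∧
    (Nonscalar p x → Nonscalar q y →
      ∀ u v : Pt F, Refactors p q x y u v ↔ (u, v) = ybMap p q (x, y))

/-- The disjointness of the roots `(c₁ + c₂) / (a₂ a₃)`, `(c₁ - 2 c₂) / (a₂ a₃)` of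
`det L(x, X, p, λ)` from the roots `(d₁ + d₂) / (b₂ b₃)`, `(d₁ - 2 d₂) / (b₂ b₃)` of
`det L(y, Y, q, λ)`. -/
def DisjointSpectra {F : Type*} [Field F] (p q : Params F) : Prop :=
  (p.c1 + p.c2) / (p.a2 * p.a3) ≠ (q.c1 + q.c2) / (q.a2 * q.a3) ∧
  (p.c1 + p.c2) / (p.a2 * p.a3) ≠ (q.c1 - 2 * q.c2) / (q.a2 * q.a3) ∧
  (p.c1 - 2 * p.c2) / (p.a2 * p.a3) ≠ (q.c1 + q.c2) / (q.a2 * q.a3) ∧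
  (p.c1 - 2 * p.c2) / (p.a2 * p.a3) ≠ (q.c1 - 2 * q.c2) / (q.a2 * q.a3)

/-- The field of rational functions over `F` in the eight coordinates of `(x, X, y, Y)`. -/
abbrev FunField (F : Type*) [Field F] := FractionRing (MvPolynomial (Fin 4 ⊕ Fin 4) F)

/-- The coordinate functions, as a point with coordinates in the function field. -/
def genericPt (F : Type*) [Field F] : Pt (FunField F) × Pt (FunField F) :=
  (fun i => algebraMap (MvPolynomial (Fin 4 ⊕ Fin 4) F) (FunField F) (MvPolynomial.X (Sum.inl i)),
    fun i => algebraMap (MvPolynomial (Fin 4 ⊕ Fin 4) F) (FunField F) (MvPolynomial.X (Sum.inr i)))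

/-- The differential of a rational function. -/
def diff {F : Type*} [Field F] (f : FunField F) :
    ExteriorAlgebra (FunField F) (Ω[FunField F⁄F]) :=
  ExteriorAlgebra.ι (FunField F) (KaehlerDifferential.D F (FunField F) f)

/-- The two-form `dx₁ ∧ dX₁ + dx₂ ∧ dX₂ + dy₁ ∧ dY₁ + dy₂ ∧ dY₂`, for rational functions
`x₁, …, Y₂`. -/
def omega {F : Type*} [Field F] (w : Pt (FunField F) × Pt (FunField F)) :
    ExteriorAlgebra (FunField F) (Ω[FunField F⁄F]) :=
  diff (w.1 0) * diff (w.1 2) + diff (w.1 1) * diff (w.1 3) +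
    diff (w.2 0) * diff (w.2 2) + diff (w.2 1) * diff (w.2 3)

/-- `R_{p,q}` is symplectic: its components are well-defined rational functions
`u₁, …, V₂` of the coordinates, and
`du₁ ∧ dU₁ + du₂ ∧ dU₂ + dv₁ ∧ dV₁ + dv₂ ∧ dV₂ = dx₁ ∧ dX₁ + dx₂ ∧ dX₂ + dy₁ ∧ dY₁ + dy₂ ∧ dY₂`. -/
def IsSymplectic {F : Type*} [Field F] (p q : Params F) : Prop :=
  genericPt F ∈ ybDomain (p.map (algebraMap F (FunField F))) (q.map (algebraMap F (FunField F))) ∧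
  omega (ybMap (p.map (algebraMap F (FunField F))) (q.map (algebraMap F (FunField F)))
    (genericPt F)) = omega (genericPt F)

end YangBaxter

end

/-
The Lax matrix is `(root1 p - λ)` times an invertible diagonal matrix, plus a matrix `c ⊗ r` of
rank one. After the diagonal matrices have been moved out of a product `L(y, q, λ) L(x, p, λ)`,
refactorising it amounts to a linear substitution of determinant `disc` in the two rows and the
contragredient substitution in the two columns. The last entry of `r` is `1`, which fixes the
remaining scaling and yields the formulas of `R`.

* The inverse substitution comes from the same construction with the two points exchanged, so that
  `R` is birational. With one of the two points fixed, it is inverted instead by multiplying with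
  the adjugate of the fixed factor; this works as soon as the spectra are disjoint.
* Both sides of the Yang–Baxter equation factorise the product of the same three polynomial
  matrices. The factors are peeled off one by one: at a root of its determinant, the product
  determines the row of the outer factor and then, where it does not vanish, the column. Points with
  vanishing columns are limits of the others in the Zariski topology.
* The one-form `∑ c dr` of a point is a primitive of the symplectic form, up to sign. Under the
  linear substitution it changes by multiples, with constant coefficients, of logarithmic
  differentials, which are closed.
-/

noncomputable section

namespace YangBaxter

open Matrix

/-! ### Regular functions on principal open sets -/

section Regular

variable {F σ τ : Type*} [Field F]

/-- `f` is a regular function on `S`: there it is a quotient of polynomials whose denominator has no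
zero in `S`. -/
@[fun_prop]
def IsRegular (S : Set (σ → F)) (f : (σ → F) → F) : Prop :=
  ∃ N D : MvPolynomial σ F, ∀ z ∈ S,
    MvPolynomial.eval z D ≠ 0 ∧ f z = MvPolynomial.eval z N / MvPolynomial.eval z D

/-- `S` is a principal Zariski open set, the nonvanishing locus of one polynomial. The empty set is
principal. -/
def IsPrincipal (S : Set (σ → F)) : Prop :=
  ∃ Q : MvPolynomial σ F, ∀ z, z ∈ S ↔ MvPolynomial.eval z Q ≠ 0

variable {S T : Set (σ → F)} {f g : (σ → F) → F}

theorem IsRegular.mono (h : IsRegular T f) (hST : S ⊆ T) : IsRegular S f := by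
  obtain ⟨N, D, h⟩ := h
  exact ⟨N, D, fun z hz => h z (hST hz)⟩

theorem IsRegular.congr (h : IsRegular S f) (hfg : Set.EqOn f g S) : IsRegular S g := by
  obtain ⟨N, D, h⟩ := h
  exact ⟨N, D, fun z hz => ⟨(h z hz).1, hfg hz ▸ (h z hz).2⟩⟩

@[fun_prop]
theorem isRegular_const (c : F) : IsRegular S fun _ => c :=
  ⟨MvPolynomial.C c, 1, fun z _ => by simp⟩

@[fun_prop]
theorem isRegular_apply (i : σ) : IsRegular S fun z => z i :=
  ⟨MvPolynomial.X i, 1, fun z _ => by simp⟩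

@[fun_prop]
theorem IsRegular.add (hf : IsRegular S f) (hg : IsRegular S g) :
    IsRegular S fun z => f z + g z := by
  obtain ⟨N, D, h⟩ := hf
  obtain ⟨N', D', h'⟩ := hg
  refine ⟨N * D' + D * N', D * D', fun z hz => ?_⟩
  obtain ⟨hD, hf⟩ := h z hz
  obtain ⟨hD', hg⟩ := h' z hz
  simp only [map_mul, map_add]
  exact ⟨mul_ne_zero hD hD', by rw [hf, hg, div_add_div _ _ hD hD']⟩

@[fun_prop]
theorem IsRegular.mul (hf : IsRegular S f) (hg : IsRegular S g) :
    IsRegular S fun z => f z * g z := by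
  obtain ⟨N, D, h⟩ := hf
  obtain ⟨N', D', h'⟩ := hg
  refine ⟨N * N', D * D', fun z hz => ?_⟩
  obtain ⟨hD, hf⟩ := h z hz
  obtain ⟨hD', hg⟩ := h' z hz
  simp only [map_mul]
  exact ⟨mul_ne_zero hD hD', by rw [hf, hg, div_mul_div_comm]⟩

@[fun_prop]
theorem IsRegular.neg (hf : IsRegular S f) : IsRegular S fun z => -f z :=
  ((isRegular_const (-1)).mul hf).congr fun z _ => neg_one_mul (f z)

@[fun_prop]
theorem IsRegular.sub (hf : IsRegular S f) (hg : IsRegular S g) :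
    IsRegular S fun z => f z - g z :=
  (hf.add hg.neg).congr fun z _ => (sub_eq_add_neg (f z) (g z)).symm

@[fun_prop]
theorem IsRegular.div (hf : IsRegular S f) (hg : IsRegular S g) (h0 : ∀ z ∈ S, g z ≠ 0) :
    IsRegular S fun z => f z / g z := by
  obtain ⟨N, D, h⟩ := hf
  obtain ⟨N', D', h'⟩ := hg
  refine ⟨N * D', D * N', fun z hz => ?_⟩
  obtain ⟨hD, hf⟩ := h z hz
  obtain ⟨-, hg⟩ := h' z hz
  have hN' : MvPolynomial.eval z N' ≠ 0 := fun hN' => h0 z hz (by rw [hg, hN', zero_div])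
  simp only [map_mul]
  exact ⟨mul_ne_zero hD hN', by rw [hf, hg, div_div_div_eq]⟩

theorem IsRegular.eval_comp {f : (σ → F) → τ → F} (hf : ∀ i, IsRegular S fun z => f z i)
    (P : MvPolynomial τ F) : IsRegular S fun z => MvPolynomial.eval (f z) P := by
  induction P using MvPolynomial.induction_on with
  | C a => simpa using isRegular_const a
  | add P Q hP hQ => simpa using hP.add hQ
  | mul_X P i hP => simpa using hP.mul (hf i)

theorem IsRegular.comp {T : Set (τ → F)} {f : (τ → F) → F} {φ : (σ → F) → τ → F}
    (hf : IsRegular T f) (hφ : ∀ i, IsRegular S fun z => φ z i) (hST : Set.MapsTo φ S T) :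
    IsRegular S fun z => f (φ z) := by
  obtain ⟨N, D, h⟩ := hf
  exact ((IsRegular.eval_comp hφ N).div (IsRegular.eval_comp hφ D) fun z hz =>
    (h _ (hST hz)).1).congr fun z hz => (h _ (hST hz)).2.symm

theorem IsPrincipal.and_ne_zero (hS : IsPrincipal S) (hf : IsRegular S f) :
    IsPrincipal {z | z ∈ S ∧ f z ≠ 0} := by
  obtain ⟨Q, hQ⟩ := hS
  obtain ⟨N, D, h⟩ := hf
  refine ⟨Q * N, fun z => ?_⟩
  rw [Set.mem_ofPred_eq, map_mul, mul_ne_zero_iff, ← hQ z]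
  refine and_congr_right fun hz => ?_
  rw [(h z hz).2, div_ne_zero_iff, and_iff_left (h z hz).1]

theorem IsPrincipal.preimage {T : Set (τ → F)} {f : (σ → F) → τ → F} (hS : IsPrincipal S)
    (hT : IsPrincipal T) (hf : ∀ i, IsRegular S fun z => f z i) :
    IsPrincipal {z | z ∈ S ∧ f z ∈ T} := by
  obtain ⟨Q, hQ⟩ := hT
  simpa only [hQ] using hS.and_ne_zero (IsRegular.eval_comp hf Q)

theorem isPrincipal_univ : IsPrincipal (Set.univ : Set (σ → F)) := ⟨1, fun z => by simp⟩

theorem IsPrincipal.inter (hS : IsPrincipal S) (hT : IsPrincipal T) : IsPrincipal (S ∩ T) :=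
  hS.preimage hT isRegular_apply

theorem IsPrincipal.generically (hS : IsPrincipal S) (hne : S.Nonempty) : Generically S := by
  obtain ⟨Q, hQ⟩ := hS
  obtain ⟨z, hz⟩ := hne
  exact ⟨Q, fun h => (hQ z).1 hz (by simp [h]), fun z hz => (hQ z).2 hz⟩

theorem isBirational_of_leftInvOn {dom : Set (σ → F)} {T : Set (τ → F)}
    {f : (σ → F) → τ → F} {g : (τ → F) → σ → F} (hdom : IsPrincipal dom) (hne : dom.Nonempty)
    (hT : IsPrincipal T) (hf : ∀ j, IsRegular dom fun z => f z j)
    (hg : ∀ j, IsRegular T fun w => g w j) (hfT : Set.MapsTo f dom T)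
    (hgf : Set.LeftInvOn g f dom) (hfg : ∀ w ∈ T, g w ∈ dom → f (g w) = w) :
    IsBirational dom f := by
  obtain ⟨Q, hQ⟩ := hdom
  obtain ⟨Q', hQ'⟩ := hT.preimage ⟨Q, hQ⟩ hg
  have hmaps : ∀ z ∈ dom, f z ∈ T ∧ g (f z) ∈ dom := fun z hz =>
    ⟨hfT hz, (hgf hz).symm ▸ hz⟩
  obtain ⟨z₀, hz₀⟩ := hne
  refine ⟨Q, Q', g, ?_, ?_, fun z => (hQ z).2, ?_, ?_, ?_, ?_⟩
  · rintro rfl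
    exact (hQ z₀).1 hz₀ (map_zero _)
  · rintro rfl
    exact (hQ' (f z₀)).1 (hmaps z₀ hz₀) (map_zero _)
  · intro j
    obtain ⟨N, D, h⟩ := hf j
    exact ⟨N, D, fun z hz => h z ((hQ z).2 hz)⟩
  · intro j
    obtain ⟨N, D, h⟩ := hg j
    exact ⟨N, D, fun w hw => h w ((hQ' w).2 hw).1⟩
  · intro z hz
    have hz := (hQ z).2 hz
    exact ⟨(hQ' (f z)).1 (hmaps z hz), hgf hz⟩
  · intro w hw
    obtain ⟨hwT, hgw⟩ := (hQ' w).2 hw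
    exact ⟨(hQ (g w)).1 hgw, hfg w hwT hgw⟩

variable [Infinite F]

theorem IsPrincipal.inter_nonempty (hS : IsPrincipal S) (hT : IsPrincipal T)
    (hSne : S.Nonempty) (hTne : T.Nonempty) : (S ∩ T).Nonempty := by
  obtain ⟨Q, hQ, hQS⟩ := hS.generically hSne
  obtain ⟨Q', hQ', hQT⟩ := hT.generically hTne
  by_contra! hempty
  refine mul_ne_zero hQ hQ' (MvPolynomial.funext fun z => ?_)
  by_contra hz
  simp only [map_mul, map_zero, mul_eq_zero, not_or] at hz
  exact hempty.le ⟨hQS z hz.1, hQT z hz.2⟩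

theorem IsRegular.eqOn_of_inter (hS : IsPrincipal S) (hT : IsPrincipal T) (hTne : T.Nonempty)
    (hf : IsRegular S f) (hg : IsRegular S g) (h : Set.EqOn f g (S ∩ T)) : Set.EqOn f g S := by
  intro z hz
  by_contra hne
  obtain ⟨z', ⟨hz'S, hz'⟩, hz'T⟩ := (hS.and_ne_zero (hf.sub hg)).inter_nonempty hT
    ⟨z, hz, sub_ne_zero.2 hne⟩ hTne
  exact hz' (sub_eq_zero.2 (h ⟨hz'S, hz'T⟩))

end Regular

/-! ### Products of two rank one perturbations of scalar matrices -/

theorem intertwines_of_refactorisation {K R : Type*} [CommRing K] [Ring R] [Algebra K R]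
    {A B A' B' : R} {δ n : K} (hB : B * B = n • B) (hB' : B' * B' = n • B')
    (hsum : A' + B' = A + B) (hprod : δ • A' + A' * B' = δ • A + B * A) :
    (A + B - (δ + n) • 1) * B' = B * (A + B - (δ + n) • 1) ∧
      (A + B - (δ + n) • 1) * A' = A * (A + B - (δ + n) • 1) := by
  have hTB : (A + B - (δ + n) • 1) * B' = B * (A + B - (δ + n) • 1) := by
    have hA : δ • A - δ • A' = δ • B' - δ • B := by
      rw [← smul_sub, ← smul_sub, sub_eq_sub_iff_add_eq_add.2 (hsum.symm.trans (add_comm _ _))]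
    calc (A + B - (δ + n) • 1) * B' = (δ • A' + A' * B') - δ • A' - δ • B' := by
          rw [← hsum, sub_mul, add_mul, hB', smul_one_mul]; module
      _ = B * A - δ • B := by rw [hprod]; linear_combination (norm := module) hA
      _ = B * (A + B - (δ + n) • 1) := by
          rw [mul_sub, mul_add, hB, mul_smul_one]; module
  refine ⟨hTB, ?_⟩
  have hcomm : (A + B - (δ + n) • 1) * (A + B) = (A + B) * (A + B - (δ + n) • 1) := by
    rw [sub_mul, mul_sub, smul_one_mul, mul_smul_one]
  rw [eq_sub_of_add_eq hsum, mul_sub, hTB, hcomm, ← sub_mul, add_sub_cancel_right]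

theorem exists_eq_smul_of_vecMulVec_eq {K ι : Type*} [Field K] {w v a r : ι → K} (ha : a ≠ 0)
    (h : vecMulVec w v = vecMulVec a (-r)) : ∃ c : K, r = c • v := by
  obtain ⟨k, hk⟩ := Function.ne_iff.1 ha
  refine ⟨-(a k)⁻¹ * w k, funext fun j => mul_left_cancel₀ hk ?_⟩
  have hkj := congrFun (congrFun h k) j
  simp only [vecMulVec_apply, Pi.neg_apply] at hkj
  simp only [Pi.smul_apply, smul_eq_mul, Pi.zero_apply] at hk ⊢
  field_simp
  linear_combination hkj

/-- The data of a product `(t + δ + b ⊗ β) (t + a ⊗ α)` of two matrices depending on the scalar `t`.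
The first pair `(a, α)` belongs to the right factor. -/
@[ext]
structure RankOnePair (K ι : Type*) where
  a : ι → K
  α : ι → K
  b : ι → K
  β : ι → K
  δ : K

namespace RankOnePair

variable {K ι : Type*} [Field K] [Fintype ι] (P : RankOnePair K ι)

/-- The trace of `a ⊗ α`. -/
def m : K := P.α ⬝ᵥ P.a

/-- The trace of `b ⊗ β`. -/
def n : K := P.β ⬝ᵥ P.b

/-- The pairing in `(b ⊗ β) (a ⊗ α) = f b ⊗ α`. -/
def f : K := P.β ⬝ᵥ P.a

/-- The pairing in `(a ⊗ α) (b ⊗ β) = g a ⊗ β`. -/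
def g : K := P.α ⬝ᵥ P.b

/-- The difference of the values `-m` and `-(δ + n)` of `t` at which the factors have their other
eigenvalue zero; it plays the role of `δ` when the two factors are exchanged. -/
def δ' : K := P.δ + P.n - P.m

/-- The determinant of the two by two matrix that takes the rows of the product to the rows of the
product with factors in the opposite order. -/
def disc : K := P.δ * P.δ' - P.f * P.g

/-- The row `α'` in `(t + a' ⊗ α') (t + δ + b' ⊗ β') = (t + δ + b ⊗ β) (t + a ⊗ α)`. -/
def row : ι → K := P.δ' • P.α - P.g • P.β

/-- The column `a'` in `(t + a' ⊗ α') (t + δ + b' ⊗ β') = (t + δ + b ⊗ β) (t + a ⊗ α)`. -/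
def col : ι → K := P.disc⁻¹ • (P.δ • P.a + P.f • P.b)

/-- Exchanging the two rank one matrices. The row and the column of `P.swap` are the `β'` and `b'`
of the refactorisation of `P`. -/
def swap : RankOnePair K ι := ⟨P.b, P.β, P.a, P.α, P.δ'⟩

theorem swap_δ' : P.swap.δ' = P.δ := by
  simp only [δ', swap, n, m]
  ring

theorem swap_disc : P.swap.disc = P.disc := by
  rw [disc, swap_δ', disc, mul_comm P.δ, mul_comm P.f]
  rfl

theorem swap_swap : P.swap.swap = P := by
  ext1 <;> first | rfl | exact swap_δ' P

theorem swap_row : P.swap.row = P.δ • P.β - P.f • P.α := by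
  rw [row, swap_δ']
  rfl

variable {P}

theorem disc_smul_col (h : P.disc ≠ 0) : P.disc • P.col = P.δ • P.a + P.f • P.b :=
  smul_inv_smul₀ h _

theorem disc_smul_swap_col (h : P.disc ≠ 0) : P.disc • P.swap.col = P.δ' • P.b + P.g • P.a := by
  rw [← swap_disc, disc_smul_col (swap_disc P ▸ h)]
  rfl

theorem row_dotProduct_col (h : P.disc ≠ 0) : P.row ⬝ᵥ P.col = P.m := by
  refine mul_left_cancel₀ h ?_
  rw [← smul_eq_mul, ← dotProduct_smul, disc_smul_col h, row]
  simp only [sub_dotProduct, smul_dotProduct, dotProduct_add, dotProduct_smul, smul_eq_mul, disc,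
    δ', m, n, f, g]
  ring

theorem row_dotProduct_swap_col (h : P.disc ≠ 0) : P.row ⬝ᵥ P.swap.col = P.g := by
  refine mul_left_cancel₀ h ?_
  rw [← smul_eq_mul, ← dotProduct_smul, disc_smul_swap_col h, row]
  simp only [sub_dotProduct, smul_dotProduct, dotProduct_add, dotProduct_smul, smul_eq_mul, disc,
    δ', m, n, f, g]
  ring

theorem swap_row_dotProduct_swap_col (h : P.disc ≠ 0) : P.swap.row ⬝ᵥ P.swap.col = P.n :=
  row_dotProduct_col (swap_disc P ▸ h)

theorem swap_row_dotProduct_col (h : P.disc ≠ 0) : P.swap.row ⬝ᵥ P.col = P.f := by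
  have := row_dotProduct_swap_col (P := P.swap) (swap_disc P ▸ h)
  rwa [swap_swap] at this

theorem row_mul_swap_row_sub (i j : ι) :
    P.row i * P.swap.row j - P.row j * P.swap.row i =
      P.disc * (P.α i * P.β j - P.α j * P.β i) := by
  rw [swap_row, row, disc]
  simp only [Pi.sub_apply, Pi.smul_apply, smul_eq_mul]
  ring

theorem vecMulVec_col_row_add (h : P.disc ≠ 0) :
    vecMulVec P.col P.row + vecMulVec P.swap.col P.swap.row =
      vecMulVec P.a P.α + vecMulVec P.b P.β := by
  ext i j
  refine mul_left_cancel₀ h ?_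
  have hcol := congrFun (disc_smul_col h) i
  have hcol' := congrFun (disc_smul_swap_col h) i
  simp only [Pi.smul_apply, Pi.add_apply, smul_eq_mul] at hcol hcol'
  rw [swap_row, row]
  simp only [Matrix.add_apply, vecMulVec_apply, Pi.sub_apply, Pi.smul_apply, smul_eq_mul]
  have hdisc : P.disc = P.δ * P.δ' - P.f * P.g := rfl
  linear_combination (P.δ' * P.α j - P.g * P.β j) * hcol +
    (P.δ * P.β j - P.f * P.α j) * hcol' - (P.a i * P.α j + P.b i * P.β j) * hdisc

theorem vecMulVec_col_row_mul (h : P.disc ≠ 0) :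
    P.δ • vecMulVec P.col P.row + vecMulVec P.col P.row * vecMulVec P.swap.col P.swap.row =
      P.δ • vecMulVec P.a P.α + vecMulVec P.b P.β * vecMulVec P.a P.α := by
  have hrow : P.δ • P.row + P.g • P.swap.row = P.disc • P.α := by
    rw [swap_row, row, disc]
    module
  rw [vecMulVec_mul_vecMulVec, vecMulVec_mul_vecMulVec, row_dotProduct_swap_col h, ← vecMulVec_smul,
    ← vecMulVec_add, hrow, vecMulVec_smul, ← smul_vecMulVec, disc_smul_col h, add_vecMulVec,
    smul_vecMulVec, smul_vecMulVec, vecMulVec_smul, f]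

theorem col_ne_zero (h : P.disc ≠ 0) (ha : P.a ≠ 0) : P.col ≠ 0 := by
  intro hcol
  have hab : P.δ • P.a + P.f • P.b = 0 := by rw [← disc_smul_col h, hcol, smul_zero]
  have hα : P.δ * P.m + P.f * P.g = 0 := by
    simpa [dotProduct_add, m, g] using congrArg (P.α ⬝ᵥ ·) hab
  have hβ : P.f * (P.δ + P.n) = 0 := by
    have := congrArg (P.β ⬝ᵥ ·) hab
    simp only [dotProduct_add, dotProduct_smul, dotProduct_zero, smul_eq_mul] at this
    rw [← this, n, f]
    ring
  have hδ : P.δ = 0 := by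
    rcases mul_eq_zero.1 hβ with hf | hn
    · exact (smul_eq_zero.1 (by simpa [hf] using hab)).resolve_right ha
    · refine absurd ?_ h
      rw [disc, δ']
      linear_combination P.δ * hn - hα
  exact h (by rw [disc, hδ]; linear_combination hδ * P.m - hα)

/-- The product with factors in the opposite order, as data of the same kind: its refactorisation
is the original product. -/
def refactor (P : RankOnePair K ι) : RankOnePair K ι :=
  ⟨P.swap.col, P.swap.row, P.col, P.row, -P.δ⟩

theorem refactor_δ' (h : P.disc ≠ 0) : P.refactor.δ' = -P.δ' := by
  have hm : P.refactor.m = P.n := swap_row_dotProduct_swap_col h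
  have hn : P.refactor.n = P.m := row_dotProduct_col h
  rw [δ', hm, hn, δ']
  dsimp only [refactor]
  ring

theorem swap_refactor (h : P.disc ≠ 0) : P.swap.refactor = P.refactor.swap := by
  ext1
  · exact congrArg col (swap_swap P)
  · exact congrArg row (swap_swap P)
  · rfl
  · rfl
  · exact (refactor_δ' h).symm

theorem refactor_f (h : P.disc ≠ 0) : P.refactor.f = P.g := row_dotProduct_swap_col h

theorem refactor_g (h : P.disc ≠ 0) : P.refactor.g = P.f := swap_row_dotProduct_col h

theorem refactor_disc (h : P.disc ≠ 0) : P.refactor.disc = P.disc := by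
  rw [disc, refactor_δ' h, refactor_f h, refactor_g h, disc]
  dsimp only [refactor]
  ring

theorem refactor_row (h : P.disc ≠ 0) : P.refactor.row = -P.disc • P.β := by
  rw [row, refactor_δ' h, refactor_g h, disc]
  dsimp only [refactor]
  rw [swap_row, row]
  module

theorem refactor_col (h : P.disc ≠ 0) : P.refactor.col = (-P.disc)⁻¹ • P.b := by
  rw [eq_inv_smul_iff₀ (neg_ne_zero.2 h), neg_smul, ← refactor_disc h,
    disc_smul_col (refactor_disc h ▸ h), refactor_f h]
  dsimp only [refactor]
  refine smul_right_injective _ h ?_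
  simp only [smul_neg, smul_add, smul_comm P.disc, disc_smul_col h, disc_smul_swap_col h]
  rw [disc]
  module

theorem refactor_swap_row (h : P.disc ≠ 0) : P.refactor.swap.row = -P.disc • P.α := by
  rw [← swap_refactor h, refactor_row (swap_disc P ▸ h), swap_disc]
  rfl

theorem refactor_swap_col (h : P.disc ≠ 0) : P.refactor.swap.col = (-P.disc)⁻¹ • P.a := by
  rw [← swap_refactor h, refactor_col (swap_disc P ▸ h), swap_disc]
  rfl

/-- The pair left after multiplying the identity of `P.row` by the adjugate `t + δ + n - b ⊗ β` of
the left factor, which moves `b ⊗ β` to the other side; it recovers `(a, α)` from `(a', α')`. -/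
def slideBack (P : RankOnePair K ι) : RankOnePair K ι :=
  ⟨P.col, P.row, -P.b, P.β, P.δ + P.n⟩

theorem slideBack_δ' (h : P.disc ≠ 0) : P.slideBack.δ' = P.δ - P.m := by
  have hm : P.slideBack.m = P.m := row_dotProduct_col h
  have hn : P.slideBack.n = -P.n := dotProduct_neg _ _
  rw [δ', hm, hn]
  dsimp only [slideBack]
  ring

theorem slideBack_g : P.slideBack.g = -(P.g * (P.δ - P.m)) := by
  simp only [g, slideBack, row, dotProduct_neg, sub_dotProduct, smul_dotProduct, smul_eq_mul, δ',
    n]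
  ring

theorem disc_mul_slideBack_f (h : P.disc ≠ 0) : P.disc * P.slideBack.f = P.f * (P.δ + P.n) := by
  rw [f]
  dsimp only [slideBack]
  rw [← smul_eq_mul, ← dotProduct_smul, disc_smul_col h]
  simp only [dotProduct_add, dotProduct_smul, smul_eq_mul, f, n]
  ring

theorem disc_mul_slideBack_disc (h : P.disc ≠ 0) :
    P.disc * P.slideBack.disc = (P.δ + P.n) * (P.δ - P.m) * (P.δ * P.δ') := by
  have hdisc : P.disc = P.δ * P.δ' - P.f * P.g := rfl
  rw [show P.slideBack.disc = (P.δ + P.n) * P.slideBack.δ' - P.slideBack.f * P.slideBack.g from rfl,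
    slideBack_δ' h, slideBack_g]
  linear_combination P.g * (P.δ - P.m) * disc_mul_slideBack_f h +
    (P.δ + P.n) * (P.δ - P.m) * hdisc

theorem slideBack_row (h : P.disc ≠ 0) : P.slideBack.row = ((P.δ - P.m) * P.δ') • P.α := by
  rw [row, slideBack_δ' h, slideBack_g]
  dsimp only [slideBack]
  rw [row]
  module

theorem slideBack_disc_ne_zero (h : P.disc ≠ 0) (hδ : P.δ ≠ 0) (hδ' : P.δ' ≠ 0)
    (hn : P.δ + P.n ≠ 0) (hm : P.δ - P.m ≠ 0) : P.slideBack.disc ≠ 0 :=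
  right_ne_zero_of_mul (disc_mul_slideBack_disc h ▸
    mul_ne_zero (mul_ne_zero hn hm) (mul_ne_zero hδ hδ'))

theorem slideBack_col (h : P.disc ≠ 0) (hδ : P.δ ≠ 0) (hδ' : P.δ' ≠ 0) (hn : P.δ + P.n ≠ 0)
    (hm : P.δ - P.m ≠ 0) : P.slideBack.col = ((P.δ - P.m) * P.δ')⁻¹ • P.a := by
  have hJ := slideBack_disc_ne_zero h hδ hδ' hn hm
  have hcol : P.disc • P.slideBack.disc • P.slideBack.col = ((P.δ + P.n) * P.δ) • P.a := by
    rw [disc_smul_col hJ, smul_add, smul_smul P.disc P.slideBack.f, disc_mul_slideBack_f h,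
      smul_comm]
    dsimp only [slideBack]
    rw [disc_smul_col h]
    module
  rw [eq_inv_smul_iff₀ (mul_ne_zero hm hδ')]
  refine smul_right_injective _ (mul_ne_zero hn hδ) ?_
  dsimp only
  rw [← hcol, smul_smul, smul_smul, disc_mul_slideBack_disc h]
  ring_nf

/-- The same two rank one matrices, with rescaled rows and columns. -/
def rescale (P : RankOnePair K ι) (s t : K) : RankOnePair K ι :=
  ⟨s⁻¹ • P.a, s • P.α, t⁻¹ • P.b, t • P.β, P.δ⟩

variable {s t : K}

theorem rescale_δ' (hs : s ≠ 0) (ht : t ≠ 0) : (P.rescale s t).δ' = P.δ' := by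
  simp only [δ', n, m, rescale, smul_dotProduct, dotProduct_smul, inv_smul_smul₀ hs,
    inv_smul_smul₀ ht]

theorem swap_rescale (hs : s ≠ 0) (ht : t ≠ 0) :
    (P.rescale s t).swap = P.swap.rescale t s := by
  ext1 <;> first | rfl | exact rescale_δ' hs ht

theorem rescale_g : (P.rescale s t).g = s * t⁻¹ * P.g := by
  simp only [g, rescale, smul_dotProduct, dotProduct_smul, smul_eq_mul]
  ring

theorem rescale_f : (P.rescale s t).f = t * s⁻¹ * P.f := by
  simp only [f, rescale, smul_dotProduct, dotProduct_smul, smul_eq_mul]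
  ring

theorem rescale_disc (hs : s ≠ 0) (ht : t ≠ 0) : (P.rescale s t).disc = P.disc := by
  rw [disc, rescale_δ' hs ht, rescale_f, rescale_g, disc]
  dsimp only [rescale]
  field_simp

theorem rescale_row (hs : s ≠ 0) (ht : t ≠ 0) : (P.rescale s t).row = s • P.row := by
  rw [row, rescale_δ' hs ht, rescale_g, row]
  dsimp only [rescale]
  rw [smul_smul _ t, mul_right_comm, inv_mul_cancel_right₀ ht]
  module

theorem rescale_col (hs : s ≠ 0) (ht : t ≠ 0) : (P.rescale s t).col = s⁻¹ • P.col := by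
  rw [col, rescale_disc hs ht, rescale_f, col]
  dsimp only [rescale]
  rw [smul_smul _ t⁻¹, show t * s⁻¹ * P.f * t⁻¹ = s⁻¹ * P.f by field_simp]
  module

theorem exists_row_eq_smul {a' α' b' β' : ι → K} (ha : P.a ≠ 0) (hb : P.b ≠ 0)
    (hn : β' ⬝ᵥ b' = P.n)
    (hsum : vecMulVec a' α' + vecMulVec b' β' = vecMulVec P.a P.α + vecMulVec P.b P.β)
    (hprod : P.δ • vecMulVec a' α' + vecMulVec a' α' * vecMulVec b' β' =
      P.δ • vecMulVec P.a P.α + vecMulVec P.b P.β * vecMulVec P.a P.α) :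
    (∃ c : K, P.row = c • α') ∧ ∃ c : K, P.swap.row = c • β' := by
  classical
  have hBB : vecMulVec P.b P.β * vecMulVec P.b P.β = P.n • vecMulVec P.b P.β := by
    rw [vecMulVec_mul_vecMulVec, vecMulVec_smul, n]
  have hBB' : vecMulVec b' β' * vecMulVec b' β' = P.n • vecMulVec b' β' := by
    rw [vecMulVec_mul_vecMulVec, vecMulVec_smul, hn]
  obtain ⟨hTB, hTA⟩ := intertwines_of_refactorisation hBB hBB' hsum hprod
  set T := vecMulVec P.a P.α + vecMulVec P.b P.β - (P.δ + P.n) • (1 : Matrix ι ι K) with hT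
  have hαT : P.α ᵥ* T = -P.row := by
    rw [hT, vecMul_sub, vecMul_add, vecMul_vecMulVec, vecMul_vecMulVec, vecMul_smul, vecMul_one,
      row, δ', m, g]
    module
  have hβT : P.β ᵥ* T = -P.swap.row := by
    rw [hT, vecMul_sub, vecMul_add, vecMul_vecMulVec, vecMul_vecMulVec, vecMul_smul, vecMul_one,
      swap_row, n, f]
    module
  rw [mul_vecMulVec, vecMulVec_mul, hαT] at hTA
  rw [mul_vecMulVec, vecMulVec_mul, hβT] at hTB
  exact ⟨exists_eq_smul_of_vecMulVec_eq ha hTA, exists_eq_smul_of_vecMulVec_eq hb hTB⟩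

end RankOnePair

/-! ### The rank one structure of the Lax matrix -/

section Gauge

variable {K : Type*} [Field K]

/-- The diagonal of the coefficient of `-λ` in the Lax matrix. -/
def diagVec (p : Params K) : Fin 3 → K := ![p.a1, p.a2, p.a3]

/-- The row of the rank one part of the Lax matrix. -/
def laxRow (p : Params K) (x : Pt K) : Fin 3 → K := ![-(p.a1 * x 0), -(p.a2 * x 1), 1]

/-- The column of the rank one part of the Lax matrix. -/
def laxCol (p : Params K) (x : Pt K) : Fin 3 → K :=
  ![x 2, x 3, p.a3 * (x 0 * x 2 + x 1 * x 3) - 3 * p.c2 / p.a2]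

/-- The double root of the determinant of the Lax matrix. -/
def root1 (p : Params K) : K := (p.c1 + p.c2) / (p.a2 * p.a3)

/-- The simple root of the determinant of the Lax matrix. -/
def root2 (p : Params K) : K := (p.c1 - 2 * p.c2) / (p.a2 * p.a3)

/-- The difference of the roots of the determinant of the Lax matrix. -/
def gap (p : Params K) : K := -(3 * p.c2) / (p.a2 * p.a3)

/-- The row of the rank one part, scaled by the diagonal matrix `W`. -/
def gaugeRow (p : Params K) (W : Fin 3 → K) (x : Pt K) : Fin 3 → K := W * laxRow p x

/-- The column of the rank one part, scaled so that together with `gaugeRow p W x` it describes a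
conjugate of the Lax matrix made monic. -/
def gaugeCol (p : Params K) (W : Fin 3 → K) (x : Pt K) : Fin 3 → K :=
  laxCol p x / (diagVec p * W)

/-- The point with given `gaugeRow` and `gaugeCol`, up to a scalar exchanged between the two. -/
def ofGauge (p : Params K) (W α a : Fin 3 → K) : Pt K :=
  ![-(α 0 / W 0) / (α 2 / W 2) / p.a1, -(α 1 / W 1) / (α 2 / W 2) / p.a2,
    α 2 / W 2 * (p.a1 * W 0 * a 0), α 2 / W 2 * (p.a2 * W 1 * a 1)]

theorem root2_eq_root1_add_gap (p : Params K) : root2 p = root1 p + gap p := by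
  simp only [root1, root2, gap]
  ring

variable {p : Params K} {W : Fin 3 → K}

theorem diagVec_ne_zero (hp : p ∈ admissible K) (k : Fin 3) : diagVec p k ≠ 0 := by
  obtain ⟨h1, h2, h3⟩ := hp
  fin_cases k <;> assumption

theorem lax_eq_smul_diagonal_add_vecMulVec (hp : p ∈ admissible K) (x : Pt K) (lam : K) :
    lax x p lam = (root1 p - lam) • diagonal (diagVec p) + vecMulVec (laxCol p x) (laxRow p x) := by
  obtain ⟨h1, h2, h3⟩ := hp
  ext i j
  fin_cases i <;> fin_cases j <;>
    simp [lax, laxRow, laxCol, diagVec, root1, diagonal] <;> field_simp <;> ring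

theorem gaugeRow_dotProduct_gaugeCol (hp : p ∈ admissible K) (hW : ∀ k, W k ≠ 0) (x : Pt K) :
    gaugeRow p W x ⬝ᵥ gaugeCol p W x = gap p := by
  obtain ⟨h1, h2, h3⟩ := hp
  have hW0 := hW 0
  have hW1 := hW 1
  have hW2 := hW 2
  simp only [dotProduct, Fin.sum_univ_three, gaugeRow, gaugeCol, laxRow, laxCol, diagVec, gap,
    Pi.mul_apply, Pi.div_apply, cons_val]
  field_simp
  ring

theorem gaugeCol_eq_zero_iff (hp : p ∈ admissible K) (hW : ∀ k, W k ≠ 0) {x : Pt K} :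
    gaugeCol p W x = 0 ↔ laxCol p x = 0 := by
  have h : ∀ k, diagVec p k * W k ≠ 0 := fun k => mul_ne_zero (diagVec_ne_zero hp k) (hW k)
  simp only [funext_iff, gaugeCol, Pi.div_apply, Pi.mul_apply, Pi.zero_apply, div_eq_zero_iff, h,
    or_false]

theorem diagonal_mul_vecMulVec_gauge (hp : p ∈ admissible K) (hW : ∀ k, W k ≠ 0) (x : Pt K) :
    diagonal (diagVec p * W) * vecMulVec (gaugeCol p W x) (gaugeRow p W x) =
      vecMulVec (laxCol p x) (laxRow p x) * diagonal W := by
  ext i j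
  have hi := diagVec_ne_zero hp i
  have hWi := hW i
  simp only [diagonal_mul, mul_diagonal, vecMulVec_apply, gaugeCol, gaugeRow, Pi.mul_apply,
    Pi.div_apply]
  field_simp

theorem ofGauge_gauge (hp : p ∈ admissible K) (hW : ∀ k, W k ≠ 0) (x : Pt K) :
    ofGauge p W (gaugeRow p W x) (gaugeCol p W x) = x := by
  obtain ⟨h1, h2, -⟩ := hp
  have hW0 := hW 0
  have hW1 := hW 1
  have hW2 := hW 2
  ext i
  fin_cases i <;>
    simp [ofGauge, gaugeRow, gaugeCol, laxRow, laxCol, diagVec] <;> field_simp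

theorem ofGauge_smul {s : K} (hs : s ≠ 0) (α a : Fin 3 → K) :
    ofGauge p W (s • α) (s⁻¹ • a) = ofGauge p W α a := by
  ext i
  fin_cases i <;> simp [ofGauge] <;> field_simp

variable {α a : Fin 3 → K}

theorem gaugeRow_ofGauge (hp : p ∈ admissible K) (hW : ∀ k, W k ≠ 0) (hα : α 2 ≠ 0) :
    gaugeRow p W (ofGauge p W α a) = (W 2 / α 2) • α := by
  obtain ⟨h1, h2, -⟩ := hp
  have hW0 := hW 0
  have hW1 := hW 1
  have hW2 := hW 2
  ext i
  fin_cases i <;> simp [gaugeRow, laxRow, ofGauge] <;> field_simp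

theorem gaugeCol_ofGauge (hp : p ∈ admissible K) (hW : ∀ k, W k ≠ 0) (hα : α 2 ≠ 0)
    (ha : α ⬝ᵥ a = gap p) :
    gaugeCol p W (ofGauge p W α a) = (W 2 / α 2)⁻¹ • a := by
  obtain ⟨h1, h2, h3⟩ := hp
  have hW0 := hW 0
  have hW1 := hW 1
  have hW2 := hW 2
  have hgap : -(3 * p.c2 / p.a2) = p.a3 * (α ⬝ᵥ a) := by
    rw [ha, gap]
    field_simp
  simp only [dotProduct, Fin.sum_univ_three] at hgap
  ext i
  simp only [gaugeCol, laxCol, ofGauge, diagVec, Pi.div_apply, Pi.mul_apply, Pi.smul_apply,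
    smul_eq_mul]
  fin_cases i
  · simp only [Fin.zero_eta, cons_val]
    field_simp
  · simp only [Fin.mk_one, cons_val]
    field_simp
  · simp only [Fin.reduceFinMk, cons_val, sub_eq_add_neg _ (3 * p.c2 / p.a2), hgap]
    field_simp
    ring

end Gauge

/-! ### The refactorisation problem -/

section Refactorisation

variable {K : Type*} [Field K] {p q : Params K}

/-- The product `L(y, q, λ) L(x, p, λ)` with the diagonal matrices moved to the left and removed, as
a product of rank one perturbations of scalar matrices; `t` stands for `root1 p - λ`. -/
def laxPair (p q : Params K) (x y : Pt K) : RankOnePair K (Fin 3) where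
  a := gaugeCol p 1 x
  α := gaugeRow p 1 x
  b := gaugeCol q (diagVec p) y
  β := gaugeRow q (diagVec p) y
  δ := root1 q - root1 p

theorem laxPair_m (hp : p ∈ admissible K) (x y : Pt K) : (laxPair p q x y).m = gap p :=
  gaugeRow_dotProduct_gaugeCol hp (fun _ => one_ne_zero) x

theorem laxPair_n (hp : p ∈ admissible K) (hq : q ∈ admissible K) (x y : Pt K) :
    (laxPair p q x y).n = gap q :=
  gaugeRow_dotProduct_gaugeCol hq (diagVec_ne_zero hp) y

theorem laxPair_δ' (hp : p ∈ admissible K) (hq : q ∈ admissible K) (x y : Pt K) :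
    (laxPair p q x y).δ' = root2 q - root2 p := by
  rw [RankOnePair.δ', laxPair_m hp, laxPair_n hp hq, root2_eq_root1_add_gap,
    root2_eq_root1_add_gap, laxPair]
  ring

theorem refactors_iff_rankOne (hp : p ∈ admissible K) (hq : q ∈ admissible K) (x y u v : Pt K) :
    Refactors p q x y u v ↔
      vecMulVec (laxCol p u) (laxRow p u) * diagonal (diagVec q) +
          diagonal (diagVec p) * vecMulVec (laxCol q v) (laxRow q v) =
        diagonal (diagVec q) * vecMulVec (laxCol p x) (laxRow p x) +
          vecMulVec (laxCol q y) (laxRow q y) * diagonal (diagVec p) ∧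
      vecMulVec (laxCol p u) (laxRow p u) * ((root1 q - root1 p) • diagonal (diagVec q) +
          vecMulVec (laxCol q v) (laxRow q v)) =
        ((root1 q - root1 p) • diagonal (diagVec q) + vecMulVec (laxCol q y) (laxRow q y)) *
          vecMulVec (laxCol p x) (laxRow p x) := by
  have hcomm : diagonal (diagVec p) * diagonal (diagVec q) =
      diagonal (diagVec q) * diagonal (diagVec p) := by
    simp only [diagonal_mul_diagonal, mul_comm]
  simp only [Refactors, lax_eq_smul_diagonal_add_vecMulVec hp,
    lax_eq_smul_diagonal_add_vecMulVec hq]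
  generalize vecMulVec (laxCol p u) (laxRow p u) = U
  generalize vecMulVec (laxCol q v) (laxRow q v) = V
  generalize vecMulVec (laxCol p x) (laxRow p x) = X
  generalize vecMulVec (laxCol q y) (laxRow q y) = Y
  generalize diagonal (diagVec p) = A at hcomm ⊢
  generalize diagonal (diagVec q) = B at hcomm ⊢
  generalize root1 p = s
  generalize root1 q = t
  have hexpand : ∀ lam : K,
      ((s - lam) • A + U) * ((t - lam) • B + V) - ((t - lam) • B + Y) * ((s - lam) • A + X) =
        (s - lam) • (U * B + A * V - (B * X + Y * A)) +
          (U * ((t - s) • B + V) - ((t - s) • B + Y) * X) := fun lam => by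
    simp only [add_mul, mul_add, smul_mul_assoc, mul_smul_comm, hcomm]
    module
  constructor
  · intro h
    have hconst : U * ((t - s) • B + V) = ((t - s) • B + Y) * X := by
      have h0 := hexpand s
      rw [h s, sub_self, sub_self, zero_smul, zero_add] at h0
      exact sub_eq_zero.1 h0.symm
    refine ⟨?_, hconst⟩
    have h1 := hexpand (s - 1)
    rw [h (s - 1), hconst, sub_self, sub_self, sub_sub_cancel, one_smul, add_zero] at h1
    exact sub_eq_zero.1 h1.symm
  · rintro ⟨hlin, hconst⟩ lam
    simpa [hlin, hconst, sub_eq_zero] using hexpand lam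

theorem refactors_iff_gauge (hp : p ∈ admissible K) (hq : q ∈ admissible K) (x y u v : Pt K) :
    let P := laxPair p q x y
    let U := vecMulVec (gaugeCol p (diagVec q) u) (gaugeRow p (diagVec q) u)
    let V := vecMulVec (gaugeCol q 1 v) (gaugeRow q 1 v)
    Refactors p q x y u v ↔
      U + V = vecMulVec P.a P.α + vecMulVec P.b P.β ∧
      P.δ • U + U * V = P.δ • vecMulVec P.a P.α + vecMulVec P.b P.β * vecMulVec P.a P.α := by
  intro P U V
  have hu : vecMulVec (laxCol p u) (laxRow p u) * diagonal (diagVec q) =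
      diagonal (diagVec p * diagVec q) * U :=
    (diagonal_mul_vecMulVec_gauge hp (diagVec_ne_zero hq) u).symm
  have hv : vecMulVec (laxCol q v) (laxRow q v) = diagonal (diagVec q) * V := by
    simpa using (diagonal_mul_vecMulVec_gauge hq (W := 1) (fun _ => one_ne_zero) v).symm
  have hx : vecMulVec (laxCol p x) (laxRow p x) = diagonal (diagVec p) * vecMulVec P.a P.α := by
    change _ = diagonal (diagVec p) * vecMulVec (gaugeCol p 1 x) (gaugeRow p 1 x)
    simpa using (diagonal_mul_vecMulVec_gauge hp (W := 1) (fun _ => one_ne_zero) x).symm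
  have hy : vecMulVec (laxCol q y) (laxRow q y) * diagonal (diagVec p) =
      diagonal (diagVec p * diagVec q) * vecMulVec P.b P.β := by
    rw [mul_comm (diagVec p)]
    exact (diagonal_mul_vecMulVec_gauge hq (diagVec_ne_zero hp) y).symm
  have hpq : diagonal (diagVec p) * diagonal (diagVec q) = diagonal (diagVec p * diagVec q) :=
    diagonal_mul_diagonal ..
  have hqp : diagonal (diagVec q) * diagonal (diagVec p) = diagonal (diagVec p * diagVec q) := by
    rw [mul_comm (diagVec p)]
    exact diagonal_mul_diagonal ..
  have hunit : IsUnit (diagonal (diagVec p * diagVec q)) :=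
    isUnit_diagonal.2 (Pi.isUnit_iff.2 fun k =>
      (mul_ne_zero (diagVec_ne_zero hp k) (diagVec_ne_zero hq k)).isUnit)
  rw [refactors_iff_rankOne hp hq]
  refine and_congr ((Eq.congr ?_ ?_).trans hunit.mul_right_inj)
    ((Eq.congr ?_ ?_).trans hunit.mul_right_inj)
  · rw [hu, hv, ← mul_assoc, hpq, mul_add]
  · rw [hx, hy, ← mul_assoc, hqp, mul_add]
  · rw [mul_add, mul_smul_comm, hu, hv, ← mul_assoc, hu, mul_assoc, mul_add, mul_smul_comm]
    rfl
  · rw [add_mul, smul_mul_assoc, hx, ← mul_assoc, hqp, ← mul_assoc, hy, mul_add, mul_smul_comm,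
      mul_assoc]
    rfl

end Refactorisation

/-! ### The formulas for the map -/

section Formulas

variable {K : Type*} [Field K] {p q : Params K} {x y : Pt K}

theorem laxPair_g (hp : p ∈ admissible K) (hq : q ∈ admissible K) (x y : Pt K) :
    (laxPair p q x y).g = gap q / p.a3 - (p.a3 * x 0 - q.a1 * y 0) * y 2 / (p.a3 * q.a1) -
      (p.a3 * x 1 - q.a2 * y 1) * y 3 / (p.a3 * q.a2) := by
  obtain ⟨h1, h2, h3⟩ := hp
  obtain ⟨h4, h5, h6⟩ := hq
  simp only [RankOnePair.g, laxPair, dotProduct, Fin.sum_univ_three, gaugeRow, gaugeCol, laxRow,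
    laxCol, diagVec, gap, Pi.mul_apply, Pi.div_apply, Pi.one_apply, cons_val]
  field_simp
  ring

theorem laxPair_f (hp : p ∈ admissible K) (x y : Pt K) :
    (laxPair p q x y).f = (p.a3 * x 0 - q.a1 * y 0) * x 2 + (p.a3 * x 1 - q.a2 * y 1) * x 3 +
      p.a3 * gap p := by
  obtain ⟨h1, h2, h3⟩ := hp
  simp only [RankOnePair.f, laxPair, dotProduct, Fin.sum_univ_three, gaugeRow, gaugeCol, laxRow,
    laxCol, diagVec, gap, Pi.mul_apply, Pi.div_apply, Pi.one_apply, cons_val]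
  field_simp
  ring

theorem laxPair_α (x y : Pt K) :
    (laxPair p q x y).α = ![-(p.a1 * x 0), -(p.a2 * x 1), 1] := by
  simp [laxPair, gaugeRow, laxRow]

theorem laxPair_β (x y : Pt K) :
    (laxPair p q x y).β = ![-(p.a1 * q.a1 * y 0), -(p.a2 * q.a2 * y 1), p.a3] := by
  ext i
  fin_cases i <;> simp [laxPair, gaugeRow, laxRow, diagVec, mul_assoc]

theorem laxPair_row (x y : Pt K) :
    let P := laxPair p q x y
    P.row = ![p.a1 * (P.g * q.a1 * y 0 - P.δ' * x 0), p.a2 * (P.g * q.a2 * y 1 - P.δ' * x 1),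
      P.δ' - p.a3 * P.g] := by
  intro P
  ext i
  fin_cases i <;> simp [P, RankOnePair.row, laxPair_α, laxPair_β] <;> ring

theorem laxPair_swap_row (x y : Pt K) :
    let P := laxPair p q x y
    P.swap.row = ![p.a1 * (P.f * x 0 - P.δ * q.a1 * y 0), p.a2 * (P.f * x 1 - P.δ * q.a2 * y 1),
      p.a3 * P.δ - P.f] := by
  intro P
  rw [RankOnePair.swap_row]
  ext i
  fin_cases i <;> simp [P, laxPair_α, laxPair_β] <;> ring

theorem C1_eq (hp : p ∈ admissible K) (hq : q ∈ admissible K) (x y : Pt K) :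
    C1 p q = p.a2 * p.a3 * q.a1 * q.a2 * q.a3 * (laxPair p q x y).δ' := by
  rw [laxPair_δ' hp hq, C1, root2, root2]
  obtain ⟨-, h2, h3⟩ := hp
  obtain ⟨h4, h5, h6⟩ := hq
  field_simp

theorem C2_eq (hp : p ∈ admissible K) (hq : q ∈ admissible K) (x y : Pt K) :
    C2 p q = -(p.a2 * q.a2 * q.a3) * (laxPair p q x y).δ := by
  obtain ⟨-, h2, h3⟩ := hp
  obtain ⟨-, h5, h6⟩ := hq
  simp only [C2, laxPair, root1]
  field_simp
  ring

theorem D1_eq (hp : p ∈ admissible K) (hq : q ∈ admissible K) (x y : Pt K) :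
    D1 p q x y = p.a2 * p.a3 * q.a1 * q.a2 * q.a3 * (laxPair p q x y).row 2 := by
  rw [laxPair_row, D1, C1_eq hp hq x y]
  simp only [cons_val, laxPair_g hp hq, gap]
  obtain ⟨-, h2, h3⟩ := hp
  obtain ⟨h4, h5, h6⟩ := hq
  field_simp
  ring

theorem D2_eq (hp : p ∈ admissible K) (hq : q ∈ admissible K) (x y : Pt K) :
    D2 p q x y = -(p.a2 * q.a2 * q.a3) * (q.a1 * (laxPair p q x y).swap.row 2) := by
  rw [laxPair_swap_row, D2, C1]
  simp only [cons_val, laxPair_f hp, gap]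
  simp only [laxPair, root1]
  obtain ⟨-, h2, h3⟩ := hp
  obtain ⟨h4, h5, h6⟩ := hq
  field_simp
  ring

theorem C1_div_D1 (hp : p ∈ admissible K) (hq : q ∈ admissible K) (x y : Pt K) :
    C1 p q / D1 p q x y = (laxPair p q x y).δ' / (laxPair p q x y).row 2 := by
  rw [C1_eq hp hq x y, D1_eq hp hq]
  obtain ⟨-, h2, h3⟩ := hp
  obtain ⟨h4, h5, h6⟩ := hq
  exact mul_div_mul_left _ _ (by simp [*])

theorem C2_div_D2 (hp : p ∈ admissible K) (hq : q ∈ admissible K) (x y : Pt K) :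
    C2 p q / D2 p q x y = (laxPair p q x y).δ / (q.a1 * (laxPair p q x y).swap.row 2) := by
  rw [C2_eq hp hq x y, D2_eq hp hq]
  obtain ⟨-, h2, -⟩ := hp
  obtain ⟨-, h5, h6⟩ := hq
  exact mul_div_mul_left _ _ (by simp [*])

variable (hp : p ∈ admissible K) (hq : q ∈ admissible K)
include hp hq

theorem u1_eq_row_div (h : (laxPair p q x y).row 2 ≠ 0) :
    u1 p q x y = -(q.a3 * (laxPair p q x y).row 0) / (p.a1 * q.a1 * (laxPair p q x y).row 2) := by
  have hrow := laxPair_row (p := p) (q := q) x y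
  rw [u1, C1_div_D1 hp hq]
  simp only [hrow, cons_val] at h ⊢
  obtain ⟨h1, -, h3⟩ := hp
  obtain ⟨h4, -, -⟩ := hq
  field_simp
  ring

theorem u2_eq_row_div (h : (laxPair p q x y).row 2 ≠ 0) :
    u2 p q x y = -(q.a3 * (laxPair p q x y).row 1) / (p.a2 * q.a2 * (laxPair p q x y).row 2) := by
  have hrow := laxPair_row (p := p) (q := q) x y
  rw [u2, C1_div_D1 hp hq]
  simp only [hrow, cons_val] at h ⊢
  obtain ⟨-, h2, h3⟩ := hp
  obtain ⟨-, h5, -⟩ := hq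
  field_simp
  ring

theorem v1_eq_row_div (h : (laxPair p q x y).swap.row 2 ≠ 0) :
    v1 p q x y = -(laxPair p q x y).swap.row 0 / (q.a1 * (laxPair p q x y).swap.row 2) := by
  have hrow := congrFun (laxPair_swap_row (p := p) (q := q) x y)
  have hrow0 := hrow 0
  have hrow2 := hrow 2
  simp only [cons_val] at hrow0 hrow2
  rw [v1, C2_div_D2 hp hq, hrow0]
  obtain ⟨h4, -, -⟩ := hq
  field_simp
  linear_combination p.a1 * x 0 * hrow2

theorem v2_eq_row_div (h : (laxPair p q x y).swap.row 2 ≠ 0) :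
    v2 p q x y = -(laxPair p q x y).swap.row 1 / (q.a2 * (laxPair p q x y).swap.row 2) := by
  have hrow := congrFun (laxPair_swap_row (p := p) (q := q) x y)
  have hrow1 := hrow 1
  have hrow2 := hrow 2
  simp only [cons_val] at hrow1 hrow2
  rw [v2, C2_div_D2 hp hq, hrow1]
  obtain ⟨h4, h5, -⟩ := hq
  field_simp
  linear_combination p.a2 * x 1 * hrow2

theorem E1_eq_disc_div (h : (laxPair p q x y).row 2 ≠ 0) (h' : (laxPair p q x y).swap.row 2 ≠ 0) :
    E1 p q x y = p.a1 * q.a3 / q.a1 * ((laxPair p q x y).disc * (p.a3 * x 0 - q.a1 * y 0)) /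
      ((laxPair p q x y).row 2 * (laxPair p q x y).swap.row 2) := by
  have hdet := (laxPair p q x y).row_mul_swap_row_sub 0 2
  simp only [laxPair_α, laxPair_β, cons_val] at hdet
  rw [E1, u1_eq_row_div hp hq h, v1_eq_row_div hp hq h']
  obtain ⟨h1, -, -⟩ := hp
  obtain ⟨h4, -, -⟩ := hq
  field_simp
  linear_combination -q.a3 * hdet

theorem E2_eq_disc_div (h : (laxPair p q x y).row 2 ≠ 0) (h' : (laxPair p q x y).swap.row 2 ≠ 0) :
    E2 p q x y = p.a2 * q.a3 / q.a2 * ((laxPair p q x y).disc * (p.a3 * x 1 - q.a2 * y 1)) /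
      ((laxPair p q x y).row 2 * (laxPair p q x y).swap.row 2) := by
  have hdet := (laxPair p q x y).row_mul_swap_row_sub 1 2
  simp only [laxPair_α, laxPair_β, cons_val] at hdet
  rw [E2, u2_eq_row_div hp hq h, v2_eq_row_div hp hq h']
  obtain ⟨-, h2, -⟩ := hp
  obtain ⟨-, h5, -⟩ := hq
  field_simp
  linear_combination -q.a3 * hdet

theorem mem_ybDomain_iff :
    (x, y) ∈ ybDomain p q ↔
      (laxPair p q x y).row 2 ≠ 0 ∧ (laxPair p q x y).swap.row 2 ≠ 0 ∧
        (laxPair p q x y).disc ≠ 0 ∧ p.a3 * x 0 - q.a1 * y 0 ≠ 0 ∧ p.a3 * x 1 - q.a2 * y 1 ≠ 0 := by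
  obtain ⟨h1, h2, h3⟩ := id hp
  obtain ⟨h4, h5, h6⟩ := id hq
  have hD1 : D1 p q x y ≠ 0 ↔ (laxPair p q x y).row 2 ≠ 0 := by
    simp [D1_eq hp hq, h2, h3, h4, h5, h6]
  have hD2 : D2 p q x y ≠ 0 ↔ (laxPair p q x y).swap.row 2 ≠ 0 := by
    simp [D2_eq hp hq, h2, h4, h5, h6]
  rw [ybDomain, Set.mem_ofPred_eq, hD1, hD2]
  refine and_congr_right fun hr => and_congr_right fun hs => ?_
  simp [E1_eq_disc_div hp hq hr hs, E2_eq_disc_div hp hq hr hs, h1, h2, h4, h5, h6, hr, hs]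
  tauto

end Formulas

/-! ### The map is the solution of the refactorisation problem -/

section Solution

variable {K : Type*} [Field K] {p q : Params K} {x y u v : Pt K}

theorem eq_div_and_eq_div_of_momentum_eq {a b c d u v x y U V X Y : K} (h : a * u - c * v ≠ 0)
    (hsum : c * U + a * V = b * X + d * Y) (hpair : u * U + v * V = x * X + y * Y) :
    U = ((a * x - b * v) * X + (a * y - d * v) * Y) / (a * u - c * v) ∧
      V = ((b * u - c * x) * X + (d * u - c * y) * Y) / (a * u - c * v) := by
  constructor
  · rw [eq_div_iff h]
    linear_combination a * hpair - v * hsum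
  · rw [eq_div_iff h]
    linear_combination u * hsum - c * hpair

theorem Refactors.eq_ybMap (hp : p ∈ admissible K) (hq : q ∈ admissible K)
    (h : Refactors p q x y u v) (hd : (x, y) ∈ ybDomain p q) (h0 : u 0 = u1 p q x y)
    (h1 : u 1 = u2 p q x y) (h2 : v 0 = v1 p q x y) (h3 : v 1 = v2 p q x y) :
    (u, v) = ybMap p q (x, y) := by
  have hsum (i j : Fin 3) := congrFun (congrFun ((refactors_iff_rankOne hp hq x y u v).1 h).1 i) j
  simp only [Matrix.add_apply, mul_diagonal, diagonal_mul, vecMulVec_apply] at hsum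
  have hUV1 := eq_div_and_eq_div_of_momentum_eq (a := p.a1) (b := q.a1) (c := q.a3) (d := p.a3)
    (U := u 2) (V := v 2) (X := x 2) (Y := y 2) (x := x 0) (y := y 0) hd.2.2.1
    (by simpa [laxRow, laxCol, diagVec, mul_comm] using hsum 0 2)
    (by
      have := hsum 0 0
      simp only [laxRow, laxCol, diagVec, cons_val] at this
      refine mul_left_cancel₀ (mul_ne_zero hp.1 hq.1) ?_
      rw [← h0, ← h2]
      linear_combination -this)
  have hUV2 := eq_div_and_eq_div_of_momentum_eq (a := p.a2) (b := q.a2) (c := q.a3) (d := p.a3)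
    (U := u 3) (V := v 3) (X := x 3) (Y := y 3) (x := x 1) (y := y 1) hd.2.2.2
    (by simpa [laxRow, laxCol, diagVec, mul_comm] using hsum 1 2)
    (by
      have := hsum 1 1
      simp only [laxRow, laxCol, diagVec, cons_val] at this
      refine mul_left_cancel₀ (mul_ne_zero hp.2.1 hq.2.1) ?_
      rw [← h1, ← h3]
      linear_combination -this)
  refine Prod.ext (funext fun i => ?_) (funext fun i => ?_)
  · fin_cases i
    exacts [h0, h1, hUV1.1, hUV2.1]
  · fin_cases i
    exacts [h2, h3, hUV1.2, hUV2.2]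

theorem Refactors.eq_ybMap_of_row (hp : p ∈ admissible K) (hq : q ∈ admissible K)
    (h : Refactors p q x y u v) (hd : (x, y) ∈ ybDomain p q)
    (hu : ∃ c : K, (laxPair p q x y).row = c • gaugeRow p (diagVec q) u)
    (hv : ∃ c : K, (laxPair p q x y).swap.row = c • gaugeRow q 1 v) :
    (u, v) = ybMap p q (x, y) := by
  obtain ⟨hr, hs, -⟩ := (mem_ybDomain_iff hp hq).1 hd
  obtain ⟨c, hu⟩ := hu
  obtain ⟨c', hv⟩ := hv
  have hc : c ≠ 0 := by
    rintro rfl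
    simp [hu] at hr
  have hc' : c' ≠ 0 := by
    rintro rfl
    simp [hv] at hs
  obtain ⟨h1, h2, -⟩ := id hp
  obtain ⟨h4, h5, h6⟩ := id hq
  refine h.eq_ybMap hp hq hd ?_ ?_ ?_ ?_
  · rw [u1_eq_row_div hp hq hr, hu]
    simp [gaugeRow, laxRow, diagVec]
    field_simp
  · rw [u2_eq_row_div hp hq hr, hu]
    simp [gaugeRow, laxRow, diagVec]
    field_simp
  · rw [v1_eq_row_div hp hq hs, hv]
    simp [gaugeRow, laxRow]
    field_simp
  · rw [v2_eq_row_div hp hq hs, hv]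
    simp [gaugeRow, laxRow]
    field_simp

theorem refactors_ofGauge (hp : p ∈ admissible K) (hq : q ∈ admissible K)
    (hr : (laxPair p q x y).row 2 ≠ 0) (hs : (laxPair p q x y).swap.row 2 ≠ 0)
    (hD : (laxPair p q x y).disc ≠ 0) :
    Refactors p q x y (ofGauge p (diagVec q) (laxPair p q x y).row (laxPair p q x y).col)
      (ofGauge q 1 (laxPair p q x y).swap.row (laxPair p q x y).swap.col) := by
  set P := laxPair p q x y
  have hone : ∀ k : Fin 3, (1 : Fin 3 → K) k ≠ 0 := fun _ => one_ne_zero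
  have hB := diagVec_ne_zero hq
  have hrow : P.row ⬝ᵥ P.col = gap p := (RankOnePair.row_dotProduct_col hD).trans (laxPair_m hp x y)
  have hswap : P.swap.row ⬝ᵥ P.swap.col = gap q :=
    (RankOnePair.swap_row_dotProduct_swap_col hD).trans (laxPair_n hp hq x y)
  have hsmul : ∀ (c : K) (_ : c ≠ 0) (a r : Fin 3 → K),
      vecMulVec (c⁻¹ • a) (c • r) = vecMulVec a r := fun c hc a r => by
    rw [vecMulVec_smul, smul_vecMulVec, smul_inv_smul₀ hc]
  refine (refactors_iff_gauge hp hq _ _ _ _).2 ?_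
  rw [gaugeRow_ofGauge hp hB hr, gaugeCol_ofGauge hp hB hr hrow, gaugeRow_ofGauge hq hone hs,
    gaugeCol_ofGauge hq hone hs hswap, hsmul _ (div_ne_zero (hB 2) hr),
    hsmul _ (div_ne_zero (hone 2) hs)]
  exact ⟨RankOnePair.vecMulVec_col_row_add hD, RankOnePair.vecMulVec_col_row_mul hD⟩

theorem ybMap_eq_ofGauge (hp : p ∈ admissible K) (hq : q ∈ admissible K)
    (hd : (x, y) ∈ ybDomain p q) :
    ybMap p q (x, y) = (ofGauge p (diagVec q) (laxPair p q x y).row (laxPair p q x y).col,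
      ofGauge q 1 (laxPair p q x y).swap.row (laxPair p q x y).swap.col) := by
  obtain ⟨hr, hs, hD, -, -⟩ := (mem_ybDomain_iff hp hq).1 hd
  refine ((refactors_ofGauge hp hq hr hs hD).eq_ybMap_of_row hp hq hd ?_ ?_).symm
  · rw [gaugeRow_ofGauge hp (diagVec_ne_zero hq) hr]
    exact ⟨_, (inv_smul_smul₀ (div_ne_zero (diagVec_ne_zero hq 2) hr) _).symm⟩
  · rw [gaugeRow_ofGauge hq (W := 1) (fun _ => one_ne_zero) hs]
    exact ⟨_, (inv_smul_smul₀ (div_ne_zero one_ne_zero hs) _).symm⟩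

theorem refactors_ybMap (hp : p ∈ admissible K) (hq : q ∈ admissible K)
    (hd : (x, y) ∈ ybDomain p q) :
    Refactors p q x y (ybMap p q (x, y)).1 (ybMap p q (x, y)).2 := by
  obtain ⟨hr, hs, hD, -, -⟩ := (mem_ybDomain_iff hp hq).1 hd
  rw [ybMap_eq_ofGauge hp hq hd]
  exact refactors_ofGauge hp hq hr hs hD

theorem Refactors.eq_ybMap_of_laxCol_ne_zero (hp : p ∈ admissible K) (hq : q ∈ admissible K)
    (h : Refactors p q x y u v) (hd : (x, y) ∈ ybDomain p q) (hx : laxCol p x ≠ 0)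
    (hy : laxCol q y ≠ 0) : (u, v) = ybMap p q (x, y) := by
  have h1 : ∀ k : Fin 3, (1 : Fin 3 → K) k ≠ 0 := fun _ => one_ne_zero
  obtain ⟨hsum, hprod⟩ := (refactors_iff_gauge hp hq x y u v).1 h
  have hn : gaugeRow q 1 v ⬝ᵥ gaugeCol q 1 v = (laxPair p q x y).n :=
    (gaugeRow_dotProduct_gaugeCol hq h1 v).trans (laxPair_n hp hq x y).symm
  obtain ⟨hu, hv⟩ := RankOnePair.exists_row_eq_smul (mt (gaugeCol_eq_zero_iff hp h1).1 hx)
    (mt (gaugeCol_eq_zero_iff hq (diagVec_ne_zero hp)).1 hy) hn hsum hprod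
  exact h.eq_ybMap_of_row hp hq hd hu hv

theorem Nonscalar.laxCol_ne_zero (h3 : (3 : K) ≠ 0) (hp : p ∈ admissible K)
    (h : Nonscalar p x) : laxCol p x ≠ 0 := by
  intro h0
  have hx2 : x 2 = 0 := congrFun h0 0
  have hx3 : x 3 = 0 := congrFun h0 1
  have hc2 : p.c2 = 0 := by simpa [laxCol, hx2, hx3, h3, hp.2.1] using congrFun h0 2
  rcases h with h | h | h <;> contradiction

theorem isStrongLax_of_admissible (h3 : (3 : K) ≠ 0) (hp : p ∈ admissible K)
    (hq : q ∈ admissible K) : IsStrongLax p q := fun x y hd =>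
  ⟨refactors_ybMap hp hq hd, fun hx hy u v =>
    ⟨fun h => h.eq_ybMap_of_laxCol_ne_zero hp hq hd (hx.laxCol_ne_zero h3 hp)
        (hy.laxCol_ne_zero h3 hq),
      fun h => by
        have := refactors_ybMap hp hq hd
        rwa [← h] at this⟩⟩

end Solution

/-! ### Reversibility and birationality -/

section Reversible

variable {K : Type*} [Field K] {p q : Params K} {x y : Pt K}

theorem laxPair_ybMap (hp : p ∈ admissible K) (hq : q ∈ admissible K)
    (hd : (x, y) ∈ ybDomain p q) :
    laxPair q p (ybMap p q (x, y)).2 (ybMap p q (x, y)).1 =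
      (laxPair p q x y).refactor.rescale (1 / (laxPair p q x y).swap.row 2)
        (q.a3 / (laxPair p q x y).row 2) := by
  obtain ⟨hr, hs, hD, -, -⟩ := (mem_ybDomain_iff hp hq).1 hd
  have hone : ∀ k : Fin 3, (1 : Fin 3 → K) k ≠ 0 := fun _ => one_ne_zero
  have hB := diagVec_ne_zero hq
  have hm := (RankOnePair.row_dotProduct_col hD).trans (laxPair_m hp x y)
  have hn := (RankOnePair.swap_row_dotProduct_swap_col hD).trans (laxPair_n hp hq x y)
  rw [ybMap_eq_ofGauge hp hq hd]
  ext1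
  · exact gaugeCol_ofGauge hq hone hs hn
  · exact gaugeRow_ofGauge hq hone hs
  · exact gaugeCol_ofGauge hp hB hr hm
  · exact gaugeRow_ofGauge hp hB hr
  · exact (neg_sub _ _).symm

theorem ybMap_swap_mem_ybDomain (hp : p ∈ admissible K) (hq : q ∈ admissible K)
    {w : Pt K × Pt K} (hd : w ∈ ybDomain p q) : (ybMap p q w).swap ∈ ybDomain q p := by
  obtain ⟨x, y⟩ := w
  obtain ⟨hr, hs, hD, -, -⟩ := (mem_ybDomain_iff hp hq).1 hd
  have hs' := one_div_ne_zero hs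
  have ht' := div_ne_zero hq.2.2 hr
  refine (mem_ybDomain_iff hq hp).2 ?_
  rw [laxPair_ybMap hp hq hd, RankOnePair.rescale_row hs' ht', RankOnePair.swap_rescale hs' ht',
    RankOnePair.rescale_row ht' hs', RankOnePair.rescale_disc hs' ht', RankOnePair.refactor_row hD,
    RankOnePair.refactor_swap_row hD, RankOnePair.refactor_disc hD]
  simp only [laxPair_α, laxPair_β, Pi.smul_apply, smul_eq_mul, cons_val, mul_one]
  refine ⟨mul_ne_zero hs' (mul_ne_zero (neg_ne_zero.2 hD) hp.2.2),
    mul_ne_zero ht' (neg_ne_zero.2 hD), hD, ?_, ?_⟩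
  · rw [← neg_ne_zero, neg_sub]
    exact hd.2.2.1
  · rw [← neg_ne_zero, neg_sub]
    exact hd.2.2.2

theorem ybMap_swap_ybMap (hp : p ∈ admissible K) (hq : q ∈ admissible K) {w : Pt K × Pt K}
    (hd : w ∈ ybDomain p q) : ybMap q p (ybMap p q w).swap = w.swap := by
  obtain ⟨x, y⟩ := w
  obtain ⟨hr, hs, hD, -, -⟩ := (mem_ybDomain_iff hp hq).1 hd
  have hs' := one_div_ne_zero hs
  have ht' := div_ne_zero hq.2.2 hr
  refine (ybMap_eq_ofGauge hq hp (ybMap_swap_mem_ybDomain hp hq hd)).trans ?_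
  rw [laxPair_ybMap hp hq hd, RankOnePair.rescale_row hs' ht', RankOnePair.rescale_col hs' ht',
    RankOnePair.swap_rescale hs' ht', RankOnePair.rescale_row ht' hs',
    RankOnePair.rescale_col ht' hs', ofGauge_smul hs', ofGauge_smul ht',
    RankOnePair.refactor_row hD, RankOnePair.refactor_col hD, RankOnePair.refactor_swap_row hD,
    RankOnePair.refactor_swap_col hD, ofGauge_smul (neg_ne_zero.2 hD),
    ofGauge_smul (neg_ne_zero.2 hD)]
  exact Prod.ext (ofGauge_gauge hq (diagVec_ne_zero hp) y)
    (ofGauge_gauge hp (W := 1) (fun _ => one_ne_zero) x)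

theorem ybDomain_nonempty [Infinite K] (hp : p ∈ admissible K) (hq : q ∈ admissible K) :
    (ybDomain p q).Nonempty := by
  classical
  obtain ⟨s, hs⟩ := Infinite.exists_notMem_finset ({p.a3 * (root1 q - root1 p), 0} : Finset K)
  obtain ⟨t, ht⟩ := Infinite.exists_notMem_finset
    ({(root2 q - root2 p) / p.a3, (root1 q - root1 p) * (root2 q - root2 p) / s} : Finset K)
  simp only [Finset.mem_insert, Finset.mem_singleton, not_or] at hs ht
  set x : Pt K := ![1, 1, (s - p.a3 * gap p) / p.a3, 0] with hx
  set y : Pt K := ![0, 0, (gap q / p.a3 - t) * q.a1, 0] with hy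
  obtain ⟨-, -, h3⟩ := id hp
  obtain ⟨h4, -, -⟩ := id hq
  have hf : (laxPair p q x y).f = s := by
    simp [laxPair_f hp, hx, hy]
    field_simp
    ring
  have hg : (laxPair p q x y).g = t := by
    simp [laxPair_g hp hq, hx, hy]
    field_simp
    ring
  refine ⟨(x, y), (mem_ybDomain_iff hp hq).2 ?_⟩
  rw [laxPair_row, laxPair_swap_row, RankOnePair.disc, laxPair_δ' hp hq, hf, hg]
  refine ⟨fun h => ht.1 ?_, fun h => hs.1 ?_, fun h => ht.2 ?_, by simpa [hx, hy],
    by simpa [hx, hy]⟩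
  · rw [eq_div_iff h3, mul_comm]
    exact (sub_eq_zero.1 h).symm
  · exact (sub_eq_zero.1 h).symm
  · rw [eq_div_iff hs.2, mul_comm]
    exact (sub_eq_zero.1 h).symm

end Reversible

section RegularMap

variable {F σ : Type*} [Field F] {S : Set (σ → F)} {x y : (σ → F) → Pt F} {p q : Params F}

theorem isRegular_ybMap (hx : ∀ i, IsRegular S fun z => x z i)
    (hy : ∀ i, IsRegular S fun z => y z i)
    (hS : ∀ z ∈ S, (x z, y z) ∈ ybDomain p q) :
    (∀ i, IsRegular S fun z => (ybMap p q (x z, y z)).1 i) ∧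
      ∀ i, IsRegular S fun z => (ybMap p q (x z, y z)).2 i := by
  have hD1 : ∀ z ∈ S, D1 p q (x z) (y z) ≠ 0 := fun z hz => (hS z hz).1
  have hD2 : ∀ z ∈ S, D2 p q (x z) (y z) ≠ 0 := fun z hz => (hS z hz).2.1
  have hE1 : ∀ z ∈ S, E1 p q (x z) (y z) ≠ 0 := fun z hz => (hS z hz).2.2.1
  have hE2 : ∀ z ∈ S, E2 p q (x z) (y z) ≠ 0 := fun z hz => (hS z hz).2.2.2
  have hu1 : IsRegular S fun z => u1 p q (x z) (y z) := by
    unfold D1 at hD1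
    unfold u1 D1
    fun_prop (disch := assumption)
  have hu2 : IsRegular S fun z => u2 p q (x z) (y z) := by
    unfold D1 at hD1
    unfold u2 D1
    fun_prop (disch := assumption)
  have hv1 : IsRegular S fun z => v1 p q (x z) (y z) := by
    unfold D2 at hD2
    unfold v1 D2
    fun_prop (disch := assumption)
  have hv2 : IsRegular S fun z => v2 p q (x z) (y z) := by
    unfold D2 at hD2
    unfold v2 D2
    fun_prop (disch := assumption)
  unfold E1 at hE1
  unfold E2 at hE2
  refine ⟨fun i => ?_, fun i => ?_⟩ <;> fin_cases i
  · exact hu1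
  · exact hu2
  · simp only [ybMap, Fin.reduceFinMk, cons_val, U1, E1]
    fun_prop (disch := assumption)
  · simp only [ybMap, Fin.reduceFinMk, cons_val, U2, E2]
    fun_prop (disch := assumption)
  · exact hv1
  · exact hv2
  · simp only [ybMap, Fin.reduceFinMk, cons_val, V1, E1]
    fun_prop (disch := assumption)
  · simp only [ybMap, Fin.reduceFinMk, cons_val, V2, E2]
    fun_prop (disch := assumption)

theorem isRegular_laxPair_f (hp : p ∈ admissible F) (hx : ∀ i, IsRegular S fun z => x z i)
    (hy : ∀ i, IsRegular S fun z => y z i) :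
    IsRegular S fun z => (laxPair p q (x z) (y z)).f := by
  simp only [laxPair_f hp]
  fun_prop

theorem isRegular_laxPair_g (hp : p ∈ admissible F) (hq : q ∈ admissible F)
    (hx : ∀ i, IsRegular S fun z => x z i) (hy : ∀ i, IsRegular S fun z => y z i) :
    IsRegular S fun z => (laxPair p q (x z) (y z)).g := by
  simp only [laxPair_g hp hq, div_eq_mul_inv]
  fun_prop

theorem isPrincipal_ybDomain (hp : p ∈ admissible F) (hq : q ∈ admissible F) (hS : IsPrincipal S)
    (hx : ∀ i, IsRegular S fun z => x z i) (hy : ∀ i, IsRegular S fun z => y z i) :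
    IsPrincipal {z | z ∈ S ∧ (x z, y z) ∈ ybDomain p q} := by
  have hf := isRegular_laxPair_f (q := q) hp hx hy
  have hg := isRegular_laxPair_g hp hq hx hy
  simp only [mem_ybDomain_iff hp hq, ← mul_ne_zero_iff]
  refine hS.and_ne_zero ?_
  simp only [laxPair_row, laxPair_swap_row, RankOnePair.disc, laxPair_δ' hp hq, cons_val]
  simp only [show ∀ x y, (laxPair p q x y).δ = root1 q - root1 p from fun _ _ => rfl]
  fun_prop

theorem isBirationalPair_ybMap [Infinite F] (hp : p ∈ admissible F) (hq : q ∈ admissible F) :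
    IsBirationalPair (ybDomain p q) (ybMap p q) := by
  have hinl : ∀ S : Set (Fin 4 ⊕ Fin 4 → F), ∀ i, IsRegular S fun w => (w ∘ Sum.inl) i :=
    fun S i => isRegular_apply _
  have hinr : ∀ S : Set (Fin 4 ⊕ Fin 4 → F), ∀ i, IsRegular S fun w => (w ∘ Sum.inr) i :=
    fun S i => isRegular_apply _
  have hdom := isPrincipal_ybDomain hp hq isPrincipal_univ (hinl _) (hinr _)
  have hT := isPrincipal_ybDomain hq hp isPrincipal_univ (hinr _) (hinl _)
  simp only [Set.mem_univ, true_and] at hdom hT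
  obtain ⟨⟨x, y⟩, hxy⟩ := ybDomain_nonempty hp hq
  have hf := isRegular_ybMap (p := p) (q := q) (hinl _) (hinr _) (fun z hz => hz)
  have hg := isRegular_ybMap (p := q) (q := p) (hinr _) (hinl _) (fun z hz => hz)
  refine isBirational_of_leftInvOn hdom ⟨Sum.elim x y, hxy⟩ hT (fun j => ?_)
    (g := fun w => Sum.elim (ybMap q p (w ∘ Sum.inr, w ∘ Sum.inl)).2
      (ybMap q p (w ∘ Sum.inr, w ∘ Sum.inl)).1) (fun j => ?_) (fun w hw => ?_) (fun w hw => ?_)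
    fun w hw _ => ?_
  · rcases j with j | j
    exacts [hf.1 j, hf.2 j]
  · rcases j with j | j
    exacts [hg.2 j, hg.1 j]
  · exact ybMap_swap_mem_ybDomain hp hq hw
  · have h := ybMap_swap_ybMap hp hq hw
    exact (congrArg₂ Sum.elim (congrArg Prod.snd h) (congrArg Prod.fst h)).trans
      (Sum.elim_comp_inl_inr w)
  · have h := ybMap_swap_ybMap hq hp hw
    exact (congrArg₂ Sum.elim (congrArg Prod.fst h) (congrArg Prod.snd h)).trans
      (Sum.elim_comp_inl_inr w)

end RegularMap

/-! ### Quadrirationality -/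

section Quadrirational

variable {F : Type*} [Field F] {p q : Params F}

/-- The product of the gauged Lax matrix of the point `x`, as right factor, with the fixed left
factor `t + δ + b ⊗ β`. -/
def dressPair (p : Params F) (W b β : Fin 3 → F) (δ : F) (x : Pt F) : RankOnePair F (Fin 3) :=
  ⟨gaugeCol p W x, gaugeRow p W x, b, β, δ⟩

/-- The point moved to the left by the refactorisation of `dressPair p W b β δ x`, read off in the
gauge `W'`. -/
def dress (p : Params F) (W W' b β : Fin 3 → F) (δ : F) (x : Pt F) : Pt F :=
  ofGauge p W' (dressPair p W b β δ x).row (dressPair p W b β δ x).col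

/-- The points at which `dress p W W' b β δ` is defined. -/
def dressDomain (p : Params F) (W b β : Fin 3 → F) (δ : F) : Set (Pt F) :=
  {x | (dressPair p W b β δ x).row 2 ≠ 0 ∧ (dressPair p W b β δ x).disc ≠ 0}

variable {W W' b β : Fin 3 → F} {δ : F} {x : Pt F}

theorem dressPair_m (hp : p ∈ admissible F) (hW : ∀ k, W k ≠ 0) :
    (dressPair p W b β δ x).m = gap p :=
  gaugeRow_dotProduct_gaugeCol hp hW x

theorem dressPair_dress (hp : p ∈ admissible F) (hW : ∀ k, W k ≠ 0) (hW' : ∀ k, W' k ≠ 0)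
    (hx : x ∈ dressDomain p W b β δ) :
    dressPair p W' (-b) β (δ + β ⬝ᵥ b) (dress p W W' b β δ x) =
      (dressPair p W b β δ x).slideBack.rescale (W' 2 / (dressPair p W b β δ x).row 2) 1 := by
  have hm := (RankOnePair.row_dotProduct_col hx.2).trans (dressPair_m hp hW)
  ext1
  · exact gaugeCol_ofGauge hp hW' hx.1 hm
  · exact gaugeRow_ofGauge hp hW' hx.1
  · simp [RankOnePair.rescale, RankOnePair.slideBack, dressPair]
  · simp [RankOnePair.rescale, RankOnePair.slideBack, dressPair]
  · rfl

theorem dress_dress (hp : p ∈ admissible F) (hW : ∀ k, W k ≠ 0) (hW' : ∀ k, W' k ≠ 0)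
    (h1 : δ ≠ 0) (h2 : δ + β ⬝ᵥ b ≠ 0) (h3 : δ - gap p ≠ 0) (h4 : δ + β ⬝ᵥ b - gap p ≠ 0)
    (hx : x ∈ dressDomain p W b β δ) :
    dress p W W' b β δ x ∈ dressDomain p W' (-b) β (δ + β ⬝ᵥ b) ∧
      dress p W' W (-b) β (δ + β ⬝ᵥ b) (dress p W W' b β δ x) = x := by
  have hs := div_ne_zero (hW' 2) hx.1
  rw [← dressPair_m (W := W) (b := b) (β := β) (δ := δ) (x := x) hp hW] at h3 h4
  have hmul := mul_ne_zero h3 h4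
  have hrow := RankOnePair.slideBack_row hx.2
  have hcol := RankOnePair.slideBack_col hx.2 h1 h4 h2 h3
  have hP := dressPair_dress (W' := W') hp hW hW' hx
  have hrow' := RankOnePair.rescale_row (P := (dressPair p W b β δ x).slideBack) hs one_ne_zero
  have hcol' := RankOnePair.rescale_col (P := (dressPair p W b β δ x).slideBack) hs one_ne_zero
  refine ⟨⟨?_, ?_⟩, ?_⟩
  · rw [hP, hrow', hrow]
    refine mul_ne_zero hs (mul_ne_zero hmul ?_)
    simpa [dressPair, gaugeRow, laxRow] using hW 2
  · rw [hP, RankOnePair.rescale_disc hs one_ne_zero]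
    exact RankOnePair.slideBack_disc_ne_zero hx.2 h1 h4 h2 h3
  · refine (congrArg (fun P => ofGauge p W P.row P.col) hP).trans ?_
    rw [hrow', hcol', ofGauge_smul hs, hrow, hcol]
    exact (ofGauge_smul hmul _ _).trans (ofGauge_gauge hp hW x)

section Regular

variable {σ : Type*} {S : Set (σ → F)}

theorem isRegular_gaugeRow {x : (σ → F) → Pt F} (hx : ∀ i, IsRegular S fun z => x z i)
    (k : Fin 3) : IsRegular S fun z => gaugeRow p W (x z) k := by
  have hrow : IsRegular S fun z => laxRow p (x z) k := by
    fin_cases k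
    exacts [((isRegular_const _).mul (hx 0)).neg, ((isRegular_const _).mul (hx 1)).neg,
      isRegular_const 1]
  exact (isRegular_const (W k)).mul hrow

theorem isRegular_gaugeCol {x : (σ → F) → Pt F} (hx : ∀ i, IsRegular S fun z => x z i)
    (k : Fin 3) : IsRegular S fun z => gaugeCol p W (x z) k := by
  have hcol : IsRegular S fun z => laxCol p (x z) k := by
    fin_cases k
    exacts [hx 2, hx 3, ((isRegular_const _).mul
      (((hx 0).mul (hx 2)).add ((hx 1).mul (hx 3)))).sub (isRegular_const _)]
  simp only [gaugeCol, Pi.div_apply, div_eq_mul_inv]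
  fun_prop

theorem isRegular_ofGauge {α a : (σ → F) → Fin 3 → F} (hW : W 2 ≠ 0)
    (hα : ∀ k, IsRegular S fun z => α z k) (ha : ∀ k, IsRegular S fun z => a z k)
    (h : ∀ z ∈ S, α z 2 ≠ 0) (i : Fin 4) : IsRegular S fun z => ofGauge p W (α z) (a z) i := by
  have hc : ∀ (c : F) (k : Fin 3), IsRegular S fun z => α z k / c := fun c k => by
    simp only [div_eq_mul_inv]
    fun_prop
  have h2 : ∀ z ∈ S, α z 2 / W 2 ≠ 0 := fun z hz => div_ne_zero (h z hz) hW
  have hdiv : ∀ (k : Fin 3) (c : F),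
      IsRegular S fun z => -(α z k / W k) / (α z 2 / W 2) / c := fun k c => by
    simp only [div_eq_mul_inv _ c]
    exact ((hc (W k) k).neg.div (hc (W 2) 2) h2).mul (isRegular_const _)
  fin_cases i
  · exact hdiv 0 _
  · exact hdiv 1 _
  · exact (hc (W 2) 2).mul ((isRegular_const _).mul (ha 0))
  · exact (hc (W 2) 2).mul ((isRegular_const _).mul (ha 1))

end Regular

theorem isRegular_dressPair_row (W b β : Fin 3 → F) (δ : F) (S : Set (Pt F)) (k : Fin 3) :
    IsRegular S fun x => (dressPair p W b β δ x).row k := by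
  have hrow := isRegular_gaugeRow (p := p) (W := W) (isRegular_apply (S := S))
  have hcol := isRegular_gaugeCol (p := p) (W := W) (isRegular_apply (S := S))
  simp only [dressPair, RankOnePair.row, RankOnePair.δ', RankOnePair.m, RankOnePair.n,
    RankOnePair.g, dotProduct, Fin.sum_univ_three, Pi.sub_apply, Pi.smul_apply, smul_eq_mul]
  fun_prop

theorem isRegular_dressPair_disc (W b β : Fin 3 → F) (δ : F) (S : Set (Pt F)) :
    IsRegular S fun x => (dressPair p W b β δ x).disc := by
  have hrow := isRegular_gaugeRow (p := p) (W := W) (isRegular_apply (S := S))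
  have hcol := isRegular_gaugeCol (p := p) (W := W) (isRegular_apply (S := S))
  simp only [dressPair, RankOnePair.disc, RankOnePair.δ', RankOnePair.m, RankOnePair.n,
    RankOnePair.f, RankOnePair.g, dotProduct, Fin.sum_univ_three]
  fun_prop

theorem isPrincipal_dressDomain (W b β : Fin 3 → F) (δ : F) :
    IsPrincipal (dressDomain p W b β δ) := by
  simpa only [dressDomain, Set.mem_univ, true_and, Set.mem_ofPred_eq] using
    (isPrincipal_univ.and_ne_zero (isRegular_dressPair_row (p := p) W b β δ _ 2)).and_ne_zero
      (isRegular_dressPair_disc (p := p) W b β δ _)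

theorem isRegular_dress (hW' : W' 2 ≠ 0) (i : Fin 4) :
    IsRegular (dressDomain p W b β δ) fun x => dress p W W' b β δ x i := by
  have hcol := isRegular_gaugeCol (p := p) (W := W) (isRegular_apply (S := dressDomain p W b β δ))
  refine isRegular_ofGauge hW' (isRegular_dressPair_row _ _ _ _ _) (fun k => ?_)
    (fun x hx => hx.1) i
  have hdisc := isRegular_dressPair_disc (p := p) W b β δ (dressDomain p W b β δ)
  have hnum : IsRegular (dressDomain p W b β δ) fun x =>
      (dressPair p W b β δ x).δ * (dressPair p W b β δ x).a k +
        (dressPair p W b β δ x).f * (dressPair p W b β δ x).b k := by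
    simp only [dressPair, RankOnePair.f, dotProduct, Fin.sum_univ_three]
    fun_prop
  exact (hnum.div hdisc fun x hx => hx.2).congr fun _ _ => div_eq_inv_mul _ _

theorem isBirational_of_eqOn_dress {dom : Set (Pt F)} {φ : Pt F → Pt F} (hp : p ∈ admissible F)
    (hW : ∀ k, W k ≠ 0) (hW' : ∀ k, W' k ≠ 0) (h1 : δ ≠ 0) (h2 : δ + β ⬝ᵥ b ≠ 0)
    (h3 : δ - gap p ≠ 0) (h4 : δ + β ⬝ᵥ b - gap p ≠ 0) (hdom : IsPrincipal dom)
    (hne : dom.Nonempty) (hsub : dom ⊆ dressDomain p W b β δ)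
    (hφ : Set.EqOn φ (dress p W W' b β δ) dom) : IsBirational dom φ := by
  refine isBirational_of_leftInvOn (T := dressDomain p W' (-b) β (δ + β ⬝ᵥ b))
    (g := dress p W' W (-b) β (δ + β ⬝ᵥ b)) hdom hne (isPrincipal_dressDomain _ _ _ _)
    (fun j => ?_) (isRegular_dress (hW 2)) (fun x hx => ?_) (fun x hx => ?_) fun u hu hd => ?_
  · exact ((isRegular_dress (hW' 2) j).mono hsub).congr fun x hx => (congrFun (hφ hx) j).symm
  · rw [hφ hx]
    exact (dress_dress hp hW hW' h1 h2 h3 h4 (hsub hx)).1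
  · rw [hφ hx]
    exact (dress_dress hp hW hW' h1 h2 h3 h4 (hsub hx)).2
  · rw [hφ hd]
    have h := (dress_dress (b := -b) (β := β) (δ := δ + β ⬝ᵥ b) hp hW' hW h2 (by simpa)
      (by rwa [add_sub_right_comm] at h4 ⊢) (by simpa) hu).2
    simpa using h

theorem DisjointSpectra.root_sub_root_ne_zero (h : DisjointSpectra p q) :
    root1 q - root1 p ≠ 0 ∧ root2 q - root1 p ≠ 0 ∧ root1 q - root2 p ≠ 0 ∧
      root2 q - root2 p ≠ 0 := by
  simp only [sub_ne_zero]
  exact ⟨h.1.symm, h.2.1.symm, h.2.2.1.symm, h.2.2.2.symm⟩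

theorem exists_ne_and_add_mul_ne_zero [Infinite F] (a : F) {c : F} (hc : c ≠ 0) (d : F) :
    ∃ s, s ≠ a ∧ c + s * d ≠ 0 := by
  classical
  obtain ⟨s, hs⟩ := Infinite.exists_notMem_finset ({a, -c / d} : Finset F)
  simp only [Finset.mem_insert, Finset.mem_singleton, not_or] at hs
  refine ⟨s, hs.1, fun h => ?_⟩
  rcases eq_or_ne d 0 with rfl | hd
  · exact hc (by simpa using h)
  · exact hs.2 (by rw [eq_div_iff hd]; linear_combination h)

theorem exists_fst_mem_ybDomain [Infinite F] (hp : p ∈ admissible F) (hq : q ∈ admissible F)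
    (h : DisjointSpectra p q) (y : Pt F) : ∃ x, (x, y) ∈ ybDomain p q := by
  obtain ⟨h11, -, h12, h22⟩ := h.root_sub_root_ne_zero
  obtain ⟨s, hs, hs'⟩ := exists_ne_and_add_mul_ne_zero 0 h12 (y 2 / q.a1 + y 3 / q.a2)
  set g := (gap q - s * (y 2 / q.a1 + y 3 / q.a2)) / p.a3 with hg
  obtain ⟨f, hf, hf'⟩ := exists_ne_and_add_mul_ne_zero (p.a3 * (root1 q - root1 p))
    (mul_ne_zero h11 h22) (-g)
  obtain ⟨-, -, h3⟩ := id hp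
  obtain ⟨h4, h5, -⟩ := id hq
  set x : Pt F :=
    ![(s + q.a1 * y 0) / p.a3, (s + q.a2 * y 1) / p.a3, (f - p.a3 * gap p) / s, 0] with hx
  have hx0 : p.a3 * x 0 - q.a1 * y 0 = s := by simp [hx, mul_div_cancel₀ _ h3]
  have hx1 : p.a3 * x 1 - q.a2 * y 1 = s := by simp [hx, mul_div_cancel₀ _ h3]
  have hPf : (laxPair p q x y).f = f := by
    rw [laxPair_f hp, hx0, hx1]
    simp [hx, mul_div_cancel₀ _ hs]
  have hPg : (laxPair p q x y).g = g := by
    rw [laxPair_g hp hq, hx0, hx1, hg]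
    field_simp
    ring
  refine ⟨x, (mem_ybDomain_iff hp hq).2 ?_⟩
  rw [laxPair_row, laxPair_swap_row, RankOnePair.disc, laxPair_δ' hp hq, hPf, hPg, hx0, hx1]
  refine ⟨?_, sub_ne_zero.2 hf.symm, by rwa [mul_neg, ← sub_eq_add_neg] at hf', hs, hs⟩
  convert hs' using 1
  simp only [cons_val, hg, mul_div_cancel₀ _ h3, root2_eq_root1_add_gap q]
  ring

theorem exists_snd_mem_ybDomain [Infinite F] (hp : p ∈ admissible F) (hq : q ∈ admissible F)
    (h : DisjointSpectra p q) (x : Pt F) : ∃ y, (x, y) ∈ ybDomain p q := by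
  obtain ⟨h11, -, h12, h22⟩ := h.root_sub_root_ne_zero
  obtain ⟨-, -, h3⟩ := id hp
  obtain ⟨h4, h5, -⟩ := id hq
  obtain ⟨s, hs, hs'⟩ := exists_ne_and_add_mul_ne_zero 0 (mul_ne_zero h3 h12) (-(x 2 + x 3))
  set f := s * (x 2 + x 3) + p.a3 * gap p with hf
  obtain ⟨g, hg, hg'⟩ := exists_ne_and_add_mul_ne_zero ((root2 q - root2 p) / p.a3)
    (mul_ne_zero h11 h22) (-f)
  set y : Pt F := ![(p.a3 * x 0 - s) / q.a1, (p.a3 * x 1 - s) / q.a2,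
    (gap q - p.a3 * g) * q.a1 / s, 0] with hy
  have hy0 : p.a3 * x 0 - q.a1 * y 0 = s := by simp [hy, mul_div_cancel₀ _ h4]
  have hy1 : p.a3 * x 1 - q.a2 * y 1 = s := by simp [hy, mul_div_cancel₀ _ h5]
  have hPf : (laxPair p q x y).f = f := by
    rw [laxPair_f hp, hy0, hy1, hf]
    ring
  have hPg : (laxPair p q x y).g = g := by
    rw [laxPair_g hp hq, hy0, hy1]
    simp [hy]
    field_simp
    ring
  refine ⟨y, (mem_ybDomain_iff hp hq).2 ?_⟩
  rw [laxPair_row, laxPair_swap_row, RankOnePair.disc, laxPair_δ' hp hq, hPf, hPg, hy0, hy1]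
  refine ⟨fun h0 => hg ?_, ?_, ?_, hs, hs⟩
  · rw [eq_div_iff h3, mul_comm]
    exact (sub_eq_zero.1 h0).symm
  · convert hs' using 1
    simp only [cons_val, hf, root2_eq_root1_add_gap p, laxPair]
    ring
  · convert hg' using 1
    simp only [laxPair]
    ring

theorem isBirational_fst_ybMap [Infinite F] (hp : p ∈ admissible F) (hq : q ∈ admissible F)
    (h : DisjointSpectra p q) (y : Pt F) :
    IsBirational {x | (x, y) ∈ ybDomain p q} fun x => (ybMap p q (x, y)).1 := by
  obtain ⟨h11, h21, h12, h22⟩ := h.root_sub_root_ne_zero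
  have hdom := isPrincipal_ybDomain hp hq isPrincipal_univ isRegular_apply
    fun i => isRegular_const (y i)
  simp only [Set.mem_univ, true_and] at hdom
  have hn : gaugeRow q (diagVec p) y ⬝ᵥ gaugeCol q (diagVec p) y = gap q :=
    gaugeRow_dotProduct_gaugeCol hq (diagVec_ne_zero hp) y
  refine isBirational_of_eqOn_dress (b := gaugeCol q (diagVec p) y)
    (β := gaugeRow q (diagVec p) y) (δ := root1 q - root1 p) hp (fun _ => one_ne_zero)
    (diagVec_ne_zero hq) h11 ?_ ?_ ?_ hdom (exists_fst_mem_ybDomain hp hq h y)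
    (fun x hx => ?_) fun x hx => congrArg Prod.fst (ybMap_eq_ofGauge hp hq hx)
  · rw [hn]
    convert h21 using 1
    rw [root2_eq_root1_add_gap]
    ring
  · convert h12 using 1
    rw [root2_eq_root1_add_gap]
    ring
  · rw [hn]
    convert h22 using 1
    rw [root2_eq_root1_add_gap, root2_eq_root1_add_gap]
    ring
  · obtain ⟨hr, -, hD, -⟩ := (mem_ybDomain_iff hp hq).1 hx
    exact ⟨hr, hD⟩

theorem isBirational_snd_ybMap [Infinite F] (hp : p ∈ admissible F) (hq : q ∈ admissible F)
    (h : DisjointSpectra p q) (x : Pt F) :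
    IsBirational {y | (x, y) ∈ ybDomain p q} fun y => (ybMap p q (x, y)).2 := by
  obtain ⟨h11, h21, h12, h22⟩ := h.root_sub_root_ne_zero
  have hdom := isPrincipal_ybDomain hp hq isPrincipal_univ (fun i => isRegular_const (x i))
    isRegular_apply
  simp only [Set.mem_univ, true_and] at hdom
  have hm : gaugeRow p 1 x ⬝ᵥ gaugeCol p 1 x = gap p := laxPair_m (q := p) hp x x
  have hswap : ∀ y, (laxPair p q x y).swap =
      dressPair q (diagVec p) (gaugeCol p 1 x) (gaugeRow p 1 x) (root2 q - root2 p) y :=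
    fun y => laxPair_δ' hp hq x y ▸ rfl
  refine isBirational_of_eqOn_dress (b := gaugeCol p 1 x) (β := gaugeRow p 1 x)
    (δ := root2 q - root2 p) hq (diagVec_ne_zero hp) (fun _ => one_ne_zero) h22 ?_ ?_ ?_ hdom
    (exists_snd_mem_ybDomain hp hq h x) (fun y hy => ?_) fun y hy => ?_
  · rw [hm]
    convert h21 using 1
    rw [root2_eq_root1_add_gap p]
    ring
  · convert h12 using 1
    rw [root2_eq_root1_add_gap q]
    ring
  · rw [hm]
    convert h11 using 1
    rw [root2_eq_root1_add_gap, root2_eq_root1_add_gap]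
    ring
  · obtain ⟨-, hs, hD, -⟩ := (mem_ybDomain_iff hp hq).1 hy
    rw [dressDomain, Set.mem_ofPred_eq, ← hswap, RankOnePair.swap_disc]
    exact ⟨hs, hD⟩
  · refine (congrArg Prod.snd (ybMap_eq_ofGauge hp hq hy)).trans ?_
    rw [dress, ← hswap]
    rfl

theorem isQuadrirational_ybMap [Infinite F] (hp : p ∈ admissible F) (hq : q ∈ admissible F)
    (h : DisjointSpectra p q) : IsQuadrirational (ybDomain p q) (ybMap p q) :=
  ⟨isBirationalPair_ybMap hp hq, isBirational_fst_ybMap hp hq h, isBirational_snd_ybMap hp hq h⟩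

end Quadrirational

/-! ### The Yang-Baxter equation -/

section PolynomialMatrix

open Polynomial

variable {F : Type*} [Field F] {p q : Params F}

theorem smul_add_mul_smul_sub {K R : Type*} [CommRing K] [Ring R] [Algebra K R] {D E V : R}
    (s : K) {g : K} (hDE : D * E = 1) (hED : E * D = 1) (hV : V * E * V = g • V) :
    (s • D + V) * ((s + g) • E - E * V * E) = (s * (s + g)) • 1 ∧
      ((s + g) • E - E * V * E) * (s • D + V) = (s * (s + g)) • 1 := by
  have h1 : D * (E * V * E) = V * E := by rw [← mul_assoc, ← mul_assoc, hDE, one_mul]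
  have h2 : V * (E * V * E) = g • (V * E) := by
    rw [← mul_assoc, ← mul_assoc, hV, smul_mul_assoc]
  have h3 : E * V * E * D = E * V := by rw [mul_assoc, hED, mul_one]
  have h4 : E * V * E * V = g • (E * V) := by rw [mul_assoc E, mul_assoc E, hV, mul_smul_comm]
  constructor
  · simp only [add_mul, mul_sub, smul_mul_assoc, mul_smul_comm, hDE, h1, h2]
    module
  · simp only [sub_mul, mul_add, smul_mul_assoc, mul_smul_comm, hED, h3, h4]
    module

/-- The Lax matrix with `λ` an indeterminate, so that common factors can be cancelled. -/
def laxPoly (p : Params F) (x : Pt F) : Matrix (Fin 3) (Fin 3) F[X] :=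
  (C (root1 p) - X) • (diagonal (diagVec p)).map C + (vecMulVec (laxCol p x) (laxRow p x)).map C

/-- The adjugate of the Lax matrix, divided by `root1 p - λ` and by the determinant of the
coefficient of `-λ`. -/
def laxAdj (p : Params F) (x : Pt F) : Matrix (Fin 3) (Fin 3) F[X] :=
  (C (root2 p) - X) • (diagonal (diagVec p)⁻¹).map C -
    (diagonal (diagVec p)⁻¹ * vecMulVec (laxCol p x) (laxRow p x) * diagonal (diagVec p)⁻¹).map C

/-- The characteristic factors `(root1 p - λ) (root2 p - λ)` of the Lax matrix. -/
def rootPoly (p : Params F) : F[X] := (C (root1 p) - X) * (C (root2 p) - X)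

theorem C_sub_X_ne_zero (c : F) : C c - X ≠ 0 := by
  rw [← neg_sub, neg_ne_zero]
  exact X_sub_C_ne_zero c

theorem rootPoly_ne_zero (p : Params F) : rootPoly p ≠ 0 :=
  mul_ne_zero (C_sub_X_ne_zero _) (C_sub_X_ne_zero _)

theorem diagonal_mul_diagonal_inv (hp : p ∈ admissible F) :
    diagonal (diagVec p) * diagonal (diagVec p)⁻¹ = 1 := by
  rw [diagonal_mul_diagonal, ← diagonal_one]
  exact congrArg diagonal (funext fun k => mul_inv_cancel₀ (diagVec_ne_zero hp k))

theorem laxRow_dotProduct_mul_laxCol (hp : p ∈ admissible F) (x : Pt F) :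
    laxRow p x ⬝ᵥ diagonal (diagVec p)⁻¹ *ᵥ laxCol p x = gap p := by
  rw [← gaugeRow_dotProduct_gaugeCol hp (W := 1) (fun _ => one_ne_zero) x]
  congr 1
  · rw [gaugeRow, one_mul]
  · ext k
    rw [mulVec_diagonal, gaugeCol, mul_one, Pi.div_apply, div_eq_inv_mul, Pi.inv_apply]

theorem laxPoly_mul_laxAdj (hp : p ∈ admissible F) (x : Pt F) :
    laxPoly p x * laxAdj p x = rootPoly p • 1 ∧ laxAdj p x * laxPoly p x = rootPoly p • 1 := by
  have hD := congrArg (C : F →+* F[X]).mapMatrix (diagonal_mul_diagonal_inv hp)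
  have hV : vecMulVec (laxCol p x) (laxRow p x) * diagonal (diagVec p)⁻¹ *
      vecMulVec (laxCol p x) (laxRow p x) = gap p • vecMulVec (laxCol p x) (laxRow p x) := by
    rw [mul_assoc, mul_vecMulVec, vecMulVec_mul_vecMulVec, laxRow_dotProduct_mul_laxCol hp,
      vecMulVec_smul]
  have hV' := congrArg (C : F →+* F[X]).mapMatrix hV
  rw [map_mul, map_one] at hD
  rw [map_mul, map_mul] at hV'
  have hgap : C (root2 p) - X = C (root1 p) - X + C (gap p) := by
    rw [root2_eq_root1_add_gap, C_add]
    ring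
  rw [laxPoly, laxAdj, rootPoly, hgap, Matrix.map_mul, Matrix.map_mul]
  refine smul_add_mul_smul_sub _ hD (mul_eq_one_comm.1 hD) (hV'.trans ?_)
  ext1
  simp

/-- Evaluation of a matrix of polynomials. -/
abbrev evalMatrix (t : F) : Matrix (Fin 3) (Fin 3) F[X] →+* Matrix (Fin 3) (Fin 3) F :=
  (evalRingHom t).mapMatrix

theorem evalMatrix_laxPoly (hp : p ∈ admissible F) (x : Pt F) (t : F) :
    evalMatrix t (laxPoly p x) = lax x p t := by
  rw [lax_eq_smul_diagonal_add_vecMulVec hp]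
  ext i j
  simp [laxPoly, -diagonal_map]

theorem evalMatrix_laxAdj (p : Params F) (x : Pt F) (t : F) :
    evalMatrix t (laxAdj p x) = (root2 p - t) • diagonal (diagVec p)⁻¹ -
      vecMulVec (diagonal (diagVec p)⁻¹ *ᵥ laxCol p x) (laxRow p x ᵥ* diagonal (diagVec p)⁻¹) := by
  rw [← vecMulVec_mul, ← mul_vecMulVec]
  ext i j
  simp [laxAdj, diagonal_mul, mul_diagonal, -diagonal_map, -Matrix.map_mul]

theorem laxPoly_mul_laxPoly [Infinite F] {x y u v : Pt F} (hp : p ∈ admissible F)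
    (hq : q ∈ admissible F) (h : Refactors p q x y u v) :
    laxPoly p u * laxPoly q v = laxPoly q y * laxPoly p x := by
  have ht : ∀ t, evalMatrix t (laxPoly p u * laxPoly q v) =
      evalMatrix t (laxPoly q y * laxPoly p x) := fun t => by
    simpa only [map_mul, evalMatrix_laxPoly hp, evalMatrix_laxPoly hq] using h t
  ext1 i j
  exact Polynomial.funext fun t => congrFun (congrFun (ht t) i) j

theorem refactors_of_laxPoly {x y u v : Pt F} (hp : p ∈ admissible F) (hq : q ∈ admissible F)
    (h : laxPoly p u * laxPoly q v = laxPoly q y * laxPoly p x) : Refactors p q x y u v := by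
  intro t
  simpa only [map_mul, evalMatrix_laxPoly hp, evalMatrix_laxPoly hq] using
    congrArg (evalMatrix t) h

theorem laxAdj_mul_laxAdj [Infinite F] {x y u v : Pt F} (hp : p ∈ admissible F)
    (hq : q ∈ admissible F) (h : Refactors p q x y u v) :
    laxAdj q v * laxAdj p u = laxAdj p x * laxAdj q y := by
  have hcomm : ∀ M : Matrix (Fin 3) (Fin 3) F[X], ∀ h : F[X], M * h • 1 = h • M := fun M h => by
    rw [mul_smul_comm, mul_one]
  refine smul_right_injective _ (mul_ne_zero (rootPoly_ne_zero p) (rootPoly_ne_zero q)) ?_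
  calc (rootPoly p * rootPoly q) • (laxAdj q v * laxAdj p u)
      = laxAdj p x * (laxAdj q y * laxPoly q y) * laxPoly p x * laxAdj q v * laxAdj p u := by
        rw [(laxPoly_mul_laxAdj hq y).2, hcomm, smul_mul_assoc, (laxPoly_mul_laxAdj hp x).2]
        simp only [smul_smul, smul_mul_assoc, one_mul, mul_comm]
    _ = laxAdj p x * laxAdj q y * (laxPoly p u * laxPoly q v) * laxAdj q v * laxAdj p u := by
        rw [laxPoly_mul_laxPoly hp hq h]
        simp only [mul_assoc]
    _ = laxAdj p x * laxAdj q y * laxPoly p u * (laxPoly q v * laxAdj q v) * laxAdj p u := by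
        simp only [mul_assoc]
    _ = (rootPoly p * rootPoly q) • (laxAdj p x * laxAdj q y) := by
        rw [(laxPoly_mul_laxAdj hq v).1, hcomm, smul_mul_assoc, mul_assoc _ (laxPoly p u),
          (laxPoly_mul_laxAdj hp u).1, hcomm, smul_smul, mul_comm (rootPoly p)]

theorem laxRow_vecMul_laxPoly (hp : p ∈ admissible F) (x : Pt F) :
    (C ∘ (laxRow p x ᵥ* diagonal (diagVec p)⁻¹)) ᵥ* laxPoly p x =
      (C (root2 p) - X) • (C ∘ laxRow p x) := by
  have hD : (laxRow p x ᵥ* diagonal (diagVec p)⁻¹) ᵥ* diagonal (diagVec p) = laxRow p x := by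
    rw [vecMul_vecMul, mul_eq_one_comm.1 (diagonal_mul_diagonal_inv hp), vecMul_one]
  have hV : (laxRow p x ᵥ* diagonal (diagVec p)⁻¹) ᵥ* vecMulVec (laxCol p x) (laxRow p x) =
      gap p • laxRow p x := by
    rw [vecMul_vecMulVec, ← dotProduct_mulVec, laxRow_dotProduct_mul_laxCol hp]
  ext1 k
  rw [laxPoly, vecMul_add, vecMul_smul, Pi.add_apply, Pi.smul_apply, ← RingHom.map_vecMul,
    ← RingHom.map_vecMul, hD, hV, root2_eq_root1_add_gap]
  simp only [Function.comp_apply, Pi.smul_apply, smul_eq_mul, C_add, C_mul]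
  ring

theorem eq_of_laxPoly_mul_eq_laxPoly_mul {x x' : Pt F} {M M' : Matrix (Fin 3) (Fin 3) F[X]}
    (hp : p ∈ admissible F) (hrow : laxRow p x = laxRow p x')
    (h : laxPoly p x * M = laxPoly p x' * M')
    (hne : evalMatrix (root1 p) (laxPoly p x * M) ≠ 0) : x = x' ∧ M = M' := by
  have heval : ∀ (z : Pt F) (N : Matrix (Fin 3) (Fin 3) F[X]),
      evalMatrix (root1 p) (laxPoly p z * N) =
        vecMulVec (laxCol p z) (laxRow p z ᵥ* evalMatrix (root1 p) N) := fun z N => by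
    rw [map_mul, evalMatrix_laxPoly hp, lax_eq_smul_diagonal_add_vecMulVec hp, sub_self, zero_smul,
      zero_add, vecMulVec_mul]
  have hrowM : laxRow p x ᵥ* evalMatrix (root1 p) M = laxRow p x' ᵥ* evalMatrix (root1 p) M' := by
    have hM := congrArg ((C ∘ (laxRow p x ᵥ* diagonal (diagVec p)⁻¹)) ᵥ* ·) h
    simp only [← vecMul_vecMul, laxRow_vecMul_laxPoly hp] at hM
    rw [hrow, laxRow_vecMul_laxPoly hp, smul_vecMul, smul_vecMul] at hM
    replace hM := smul_right_injective _ (C_sub_X_ne_zero _) hM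
    ext k
    simpa [vecMul, dotProduct, hrow, eval_finsetSum] using congrArg (eval (root1 p)) (congrFun hM k)
  have hcol : laxCol p x = laxCol p x' := by
    have hσ : laxRow p x ᵥ* evalMatrix (root1 p) M ≠ 0 := fun h0 => hne (by
      rw [heval, h0, vecMulVec_zero])
    obtain ⟨k, hk⟩ := Function.ne_iff.1 hσ
    have := congrArg (evalMatrix (root1 p)) h
    rw [heval, heval, ← hrowM] at this
    exact funext fun i => mul_right_cancel₀ hk (congrFun (congrFun this i) k)
  have hx : x = x' := by
    have h1 : ∀ k : Fin 3, (1 : Fin 3 → F) k ≠ 0 := fun _ => one_ne_zero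
    rw [← ofGauge_gauge hp h1 x, ← ofGauge_gauge hp h1 x', gaugeRow, gaugeRow, gaugeCol, gaugeCol,
      hrow, hcol]
  refine ⟨hx, smul_right_injective _ (rootPoly_ne_zero p) ?_⟩
  have := congrArg (laxAdj p x * ·) h
  simpa only [← mul_assoc, ← hx, (laxPoly_mul_laxAdj hp x).2, smul_mul_assoc, one_mul] using this

end PolynomialMatrix

section YangBaxterEquation

variable {F : Type*} [Field F] {p q r : Params F} {x y z : Pt F}

theorem gaugeRow_ybMap_fst (hp : p ∈ admissible F) (hq : q ∈ admissible F)
    (hd : (x, y) ∈ ybDomain p q) :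
    gaugeRow p (diagVec q) (ybMap p q (x, y)).1 =
      (q.a3 / (laxPair p q x y).row 2) • (laxPair p q x y).row :=
  congrArg RankOnePair.β (laxPair_ybMap hp hq hd)

theorem gaugeCol_ybMap_fst (hp : p ∈ admissible F) (hq : q ∈ admissible F)
    (hd : (x, y) ∈ ybDomain p q) :
    gaugeCol p (diagVec q) (ybMap p q (x, y)).1 =
      (q.a3 / (laxPair p q x y).row 2)⁻¹ • (laxPair p q x y).col :=
  congrArg RankOnePair.b (laxPair_ybMap hp hq hd)

theorem gaugeRow_ybMap_snd (hp : p ∈ admissible F) (hq : q ∈ admissible F)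
    (hd : (x, y) ∈ ybDomain p q) :
    gaugeRow q 1 (ybMap p q (x, y)).2 =
      (1 / (laxPair p q x y).swap.row 2) • (laxPair p q x y).swap.row :=
  congrArg RankOnePair.α (laxPair_ybMap hp hq hd)

theorem gaugeCol_ybMap_snd (hp : p ∈ admissible F) (hq : q ∈ admissible F)
    (hd : (x, y) ∈ ybDomain p q) :
    gaugeCol q 1 (ybMap p q (x, y)).2 =
      (1 / (laxPair p q x y).swap.row 2)⁻¹ • (laxPair p q x y).swap.col :=
  congrArg RankOnePair.a (laxPair_ybMap hp hq hd)

theorem laxRow_vecMul_laxAdj (hp : p ∈ admissible F) (hq : q ∈ admissible F)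
    (hd : (x, y) ∈ ybDomain p q) :
    (laxRow p x ᵥ* diagonal (diagVec p)⁻¹) ᵥ* evalMatrix (root2 p) (laxAdj q y) =
      ((laxPair p q x y).row 2 / q.a3) •
        (laxRow p (ybMap p q (x, y)).1 ᵥ* diagonal (diagVec p)⁻¹) := by
  have hr := ((mem_ybDomain_iff hp hq).1 hd).1
  have hg : (laxRow p x ᵥ* diagonal (diagVec p)⁻¹) ⬝ᵥ diagonal (diagVec q)⁻¹ *ᵥ laxCol q y =
      (laxPair p q x y).g := by
    simp only [RankOnePair.g, laxPair, dotProduct, vecMul_diagonal, mulVec_diagonal, gaugeRow,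
      gaugeCol, Pi.mul_apply, Pi.inv_apply, Pi.one_apply, div_eq_mul_inv, mul_inv]
    exact Finset.sum_congr rfl fun k _ => by ring
  rw [evalMatrix_laxAdj, vecMul_sub, vecMul_smul, vecMul_vecMulVec, hg, ← laxPair_δ' hp hq x y]
  ext k
  have hu := congrFun (gaugeRow_ybMap_fst hp hq hd) k
  have hA := diagVec_ne_zero hp k
  have hB := diagVec_ne_zero hq k
  have hb := hq.2.2
  simp only [gaugeRow, Pi.mul_apply, Pi.smul_apply, smul_eq_mul, ← eq_inv_mul_iff_mul_eq₀ hB] at hu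
  rw [Pi.sub_apply, Pi.smul_apply, Pi.smul_apply, Pi.smul_apply]
  simp only [vecMul_diagonal, Pi.inv_apply, smul_eq_mul, hu]
  have hrow : (laxPair p q x y).row k = (laxPair p q x y).δ' * laxRow p x k -
      (laxPair p q x y).g * (diagVec p k * laxRow q y k) := by
    simp only [RankOnePair.row, laxPair, gaugeRow, one_mul, Pi.sub_apply, Pi.smul_apply,
      Pi.mul_apply, smul_eq_mul]
  field_simp
  rw [hrow]
  ring

theorem lax_mulVec_laxCol (hp : p ∈ admissible F) (hq : q ∈ admissible F)
    (hd : (x, y) ∈ ybDomain p q) :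
    lax y q (root1 p) *ᵥ laxCol p x =
      ((laxPair p q x y).disc * q.a3 / (laxPair p q x y).row 2) •
        laxCol p (ybMap p q (x, y)).1 := by
  obtain ⟨hr, -, hD, -, -⟩ := (mem_ybDomain_iff hp hq).1 hd
  have hf : laxRow q y ⬝ᵥ laxCol p x = (laxPair p q x y).f := by
    simp only [RankOnePair.f, laxPair, dotProduct, gaugeRow, gaugeCol, mul_one, Pi.mul_apply,
      Pi.div_apply]
    refine Finset.sum_congr rfl fun k _ => ?_
    have := diagVec_ne_zero hp k
    field_simp
  rw [lax_eq_smul_diagonal_add_vecMulVec hq, add_mulVec, smul_mulVec, vecMulVec_mulVec, hf,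
    op_smul_eq_smul]
  ext k
  have hu := congrFun (gaugeCol_ybMap_fst hp hq hd) k
  have hcol := congrFun (RankOnePair.disc_smul_col hD) k
  have hA := diagVec_ne_zero hp k
  have hB := diagVec_ne_zero hq k
  have hb := hq.2.2
  have hAB := mul_ne_zero hA hB
  have hδ : root1 q - root1 p = (laxPair p q x y).δ := rfl
  simp only [gaugeCol, Pi.div_apply, Pi.mul_apply, Pi.smul_apply, smul_eq_mul,
    div_eq_iff hAB] at hu
  rw [Pi.add_apply, Pi.smul_apply, Pi.smul_apply, Pi.smul_apply, mulVec_diagonal, hδ, hu]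
  have ha : (laxPair p q x y).a k = laxCol p x k / diagVec p k := by
    simp only [laxPair, gaugeCol, mul_one, Pi.div_apply]
  have hb' : (laxPair p q x y).b k = laxCol q y k / (diagVec q k * diagVec p k) := rfl
  simp only [Pi.add_apply, Pi.smul_apply, ha, hb', smul_eq_mul] at hcol ⊢
  field_simp at hcol ⊢
  linear_combination -hcol

theorem laxCol_ybMap_fst_ne_zero (hp : p ∈ admissible F) (hq : q ∈ admissible F)
    (hd : (x, y) ∈ ybDomain p q) (hx : laxCol p x ≠ 0) :
    laxCol p (ybMap p q (x, y)).1 ≠ 0 := by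
  obtain ⟨hr, -, hD, -, -⟩ := (mem_ybDomain_iff hp hq).1 hd
  rw [Ne, ← gaugeCol_eq_zero_iff hp (diagVec_ne_zero hq), gaugeCol_ybMap_fst hp hq hd]
  exact smul_ne_zero (inv_ne_zero (div_ne_zero hq.2.2 hr)) (RankOnePair.col_ne_zero hD
    (mt (gaugeCol_eq_zero_iff hp (W := 1) fun _ => one_ne_zero).1 hx))

theorem laxCol_ybMap_snd_ne_zero (hp : p ∈ admissible F) (hq : q ∈ admissible F)
    (hd : (x, y) ∈ ybDomain p q) (hy : laxCol q y ≠ 0) :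
    laxCol q (ybMap p q (x, y)).2 ≠ 0 := by
  obtain ⟨-, hs, hD, -, -⟩ := (mem_ybDomain_iff hp hq).1 hd
  rw [Ne, ← gaugeCol_eq_zero_iff hq (W := 1) (fun _ => one_ne_zero), gaugeCol_ybMap_snd hp hq hd]
  exact smul_ne_zero (inv_ne_zero (div_ne_zero one_ne_zero hs))
    (RankOnePair.col_ne_zero (by rwa [RankOnePair.swap_disc])
      (mt (gaugeCol_eq_zero_iff hq (diagVec_ne_zero hp)).1 hy))

theorem laxPoly_mul_of_refactors_snd [Infinite F] {x₁ x₂ y₁ y₂ z₁ z₂ : Pt F}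
    (hp : p ∈ admissible F) (hq : q ∈ admissible F) (hr : r ∈ admissible F)
    (hyz : Refactors q r y z y₁ z₁) (hxz : Refactors p r x z₁ x₁ z₂)
    (hxy : Refactors p q x₁ y₁ x₂ y₂) :
    laxPoly p x₂ * (laxPoly q y₂ * laxPoly r z₂) = laxPoly r z * laxPoly q y * laxPoly p x := by
  rw [← mul_assoc, laxPoly_mul_laxPoly hp hq hxy, mul_assoc, laxPoly_mul_laxPoly hp hr hxz,
    ← mul_assoc, laxPoly_mul_laxPoly hq hr hyz]

theorem laxPoly_mul_of_refactors_fst [Infinite F] {x₁ x₂ y₁ y₂ z₁ z₂ : Pt F}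
    (hp : p ∈ admissible F) (hq : q ∈ admissible F) (hr : r ∈ admissible F)
    (hxy : Refactors p q x y x₁ y₁) (hxz : Refactors p r x₁ z x₂ z₁)
    (hyz : Refactors q r y₁ z₁ y₂ z₂) :
    laxPoly p x₂ * (laxPoly q y₂ * laxPoly r z₂) = laxPoly r z * laxPoly q y * laxPoly p x := by
  rw [laxPoly_mul_laxPoly hq hr hyz, ← mul_assoc, laxPoly_mul_laxPoly hp hr hxz, mul_assoc,
    laxPoly_mul_laxPoly hp hq hxy, mul_assoc]

theorem eq_of_smul_laxRow_eq_smul_laxRow (hp : p ∈ admissible F) {c c' : F} (hc : c ≠ 0)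
    {u u' : Pt F} (h : c • (laxRow p u ᵥ* diagonal (diagVec p)⁻¹) =
      c' • (laxRow p u' ᵥ* diagonal (diagVec p)⁻¹)) : laxRow p u = laxRow p u' := by
  have hA := diagVec_ne_zero hp
  have hk : ∀ k, c * laxRow p u k = c' * laxRow p u' k := fun k => by
    have := congrFun h k
    simp only [Pi.smul_apply, vecMul_diagonal, Pi.inv_apply, smul_eq_mul, ← mul_assoc] at this
    exact mul_right_cancel₀ (inv_ne_zero (hA k)) this
  have hcc : c = c' := by simpa [laxRow] using hk 2
  exact funext fun k => mul_left_cancel₀ hc (by rw [hk k, hcc])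

theorem exists_laxRow_vecMul_laxAdj_mul_laxAdj (hp : p ∈ admissible F) (hq : q ∈ admissible F)
    (hr : r ∈ admissible F) (hxy : (x, y) ∈ ybDomain p q)
    (hz : ((ybMap p q (x, y)).1, z) ∈ ybDomain p r) :
    ∃ c : F, c ≠ 0 ∧ (laxRow p x ᵥ* diagonal (diagVec p)⁻¹) ᵥ*
        evalMatrix (root2 p) (laxAdj q y * laxAdj r z) =
      c • (laxRow p (ybMap p r ((ybMap p q (x, y)).1, z)).1 ᵥ* diagonal (diagVec p)⁻¹) := by
  have h1 := ((mem_ybDomain_iff hp hq).1 hxy).1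
  have h2 := ((mem_ybDomain_iff hp hr).1 hz).1
  refine ⟨_, mul_ne_zero (div_ne_zero h1 hq.2.2) (div_ne_zero h2 hr.2.2), ?_⟩
  rw [map_mul, ← vecMul_vecMul, laxRow_vecMul_laxAdj hp hq hxy, smul_vecMul,
    laxRow_vecMul_laxAdj hp hr hz, smul_smul]

theorem lax_mulVec_lax_mulVec_laxCol_ne_zero (hp : p ∈ admissible F) (hq : q ∈ admissible F)
    (hr : r ∈ admissible F) (hxy : (x, y) ∈ ybDomain p q)
    (hz : ((ybMap p q (x, y)).1, z) ∈ ybDomain p r) (hx : laxCol p x ≠ 0) :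
    lax z r (root1 p) *ᵥ (lax y q (root1 p) *ᵥ laxCol p x) ≠ 0 := by
  obtain ⟨h1, -, hD1, -, -⟩ := (mem_ybDomain_iff hp hq).1 hxy
  obtain ⟨h2, -, hD2, -, -⟩ := (mem_ybDomain_iff hp hr).1 hz
  rw [lax_mulVec_laxCol hp hq hxy, mulVec_smul, lax_mulVec_laxCol hp hr hz]
  exact smul_ne_zero (div_ne_zero (mul_ne_zero hD1 hq.2.2) h1)
    (smul_ne_zero (div_ne_zero (mul_ne_zero hD2 hr.2.2) h2)
      (laxCol_ybMap_fst_ne_zero hp hr hz (laxCol_ybMap_fst_ne_zero hp hq hxy hx)))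

theorem evalMatrix_laxPoly_mul_laxPoly_mul_laxPoly_ne_zero (hp : p ∈ admissible F)
    (hq : q ∈ admissible F) (hr : r ∈ admissible F) (hxy : (x, y) ∈ ybDomain p q)
    (hz : ((ybMap p q (x, y)).1, z) ∈ ybDomain p r) (hx : laxCol p x ≠ 0) :
    evalMatrix (root1 p) (laxPoly r z * laxPoly q y * laxPoly p x) ≠ 0 := by
  rw [map_mul, map_mul, evalMatrix_laxPoly hr, evalMatrix_laxPoly hq, evalMatrix_laxPoly hp,
    lax_eq_smul_diagonal_add_vecMulVec hp x, sub_self, zero_smul, zero_add, mul_vecMulVec,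
    ← mulVec_mulVec]
  exact vecMulVec_ne_zero (lax_mulVec_lax_mulVec_laxCol_ne_zero hp hq hr hxy hz hx)
    (Function.ne_iff.2 ⟨2, one_ne_zero⟩)

theorem yangBaxter_of_laxCol_ne_zero [Infinite F] (hp : p ∈ admissible F) (hq : q ∈ admissible F)
    (hr : r ∈ admissible F) (hw : (x, y, z) ∈ tripleDomain ybDomain ybMap p q r)
    (hx : laxCol p x ≠ 0) (hy : laxCol q y ≠ 0) (hz : laxCol r z ≠ 0) :
    act12 (ybMap p q) (act13 (ybMap p r) (act23 (ybMap q r) (x, y, z))) =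
      act23 (ybMap q r) (act13 (ybMap p r) (act12 (ybMap p q) (x, y, z))) := by
  have hyz : (y, z) ∈ ybDomain q r := hw.1
  have hxz₁ : (x, (ybMap q r (y, z)).2) ∈ ybDomain p r := hw.2.1
  have hx₁y₁ : ((ybMap p r (x, (ybMap q r (y, z)).2)).1, (ybMap q r (y, z)).1) ∈ ybDomain p q :=
    hw.2.2.1
  have hxy : (x, y) ∈ ybDomain p q := hw.2.2.2.1
  have hx'z : ((ybMap p q (x, y)).1, z) ∈ ybDomain p r := hw.2.2.2.2.1
  have hy'z' : ((ybMap p q (x, y)).2, (ybMap p r ((ybMap p q (x, y)).1, z)).2) ∈ ybDomain q r :=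
    hw.2.2.2.2.2
  have hrow : laxRow p (ybMap p q ((ybMap p r (x, (ybMap q r (y, z)).2)).1,
      (ybMap q r (y, z)).1)).1 = laxRow p (ybMap p r ((ybMap p q (x, y)).1, z)).1 := by
    obtain ⟨c, hc, h⟩ := exists_laxRow_vecMul_laxAdj_mul_laxAdj hp hr hq hxz₁ hx₁y₁
    obtain ⟨c', -, h'⟩ := exists_laxRow_vecMul_laxAdj_mul_laxAdj hp hq hr hxy hx'z
    rw [laxAdj_mul_laxAdj hq hr (refactors_ybMap hq hr hyz)] at h
    exact eq_of_smul_laxRow_eq_smul_laxRow hp hc (h.symm.trans h')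
  have hleft := laxPoly_mul_of_refactors_snd hp hq hr (refactors_ybMap hq hr hyz)
    (refactors_ybMap hp hr hxz₁) (refactors_ybMap hp hq hx₁y₁)
  have hright := laxPoly_mul_of_refactors_fst hp hq hr (refactors_ybMap hp hq hxy)
    (refactors_ybMap hp hr hx'z) (refactors_ybMap hq hr hy'z')
  have hne := evalMatrix_laxPoly_mul_laxPoly_mul_laxPoly_ne_zero hp hq hr hxy hx'z hx
  rw [← hleft] at hne
  obtain ⟨hfst, hM⟩ := eq_of_laxPoly_mul_eq_laxPoly_mul hp hrow (hleft.trans hright.symm) hne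
  have hsnd := (refactors_of_laxPoly hq hr (hM.trans (laxPoly_mul_laxPoly hq hr
    (refactors_ybMap hq hr hy'z')))).eq_ybMap_of_laxCol_ne_zero hq hr hy'z'
      (laxCol_ybMap_snd_ne_zero hp hq hxy hy) (laxCol_ybMap_snd_ne_zero hp hr hx'z hz)
  exact Prod.ext hfst hsnd

end YangBaxterEquation

section Pullback

variable {F ρ τ : Type*} (e : (Fin 4 ⊕ Fin 4) ⊕ ρ ≃ τ)

/-- The two points of the phase space that `e` selects among the coordinates of `z`. -/
def pairAlong (z : τ → F) : Pt F × Pt F :=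
  (fun i => z (e (Sum.inl (Sum.inl i))), fun i => z (e (Sum.inl (Sum.inr i))))

/-- `R` acting on the two points of the phase space that `e` selects among the coordinates of `z`;
this puts `act12`, `act13` and `act23` on the same footing. -/
def actAlong (R : Pt F × Pt F → Pt F × Pt F) (z : τ → F) : τ → F := fun t =>
  Sum.elim (Sum.elim (R (pairAlong e z)).1 (R (pairAlong e z)).2) (fun k => z (e (Sum.inr k)))
    (e.symm t)

variable {e} {R R' : Pt F × Pt F → Pt F × Pt F} {z : τ → F}

theorem pairAlong_actAlong : pairAlong e (actAlong e R z) = R (pairAlong e z) := by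
  simp [pairAlong, actAlong]

theorem actAlong_actAlong : actAlong e R' (actAlong e R z) = actAlong e (R' ∘ R) z := by
  ext t
  simp only [actAlong, pairAlong_actAlong, Function.comp_apply]
  rcases e.symm t with i | k <;> simp

theorem actAlong_of_eq (h : R (pairAlong e z) = pairAlong e z) : actAlong e R z = z := by
  ext t
  obtain ⟨s, rfl⟩ := e.surjective t
  rw [actAlong, h, e.symm_apply_apply]
  rcases s with (i | i) | k <;> rfl

variable [Field F] {p q : Params F} {S T : Set (τ → F)}

/-- The points at which `R_{p,q}`, acting along `e`, is defined and takes a value in `T`. -/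
def pullback (e : (Fin 4 ⊕ Fin 4) ⊕ ρ ≃ τ) (p q : Params F) (T : Set (τ → F)) : Set (τ → F) :=
  {z | pairAlong e z ∈ ybDomain p q ∧ actAlong e (ybMap p q) z ∈ T}

theorem isRegular_actAlong (hS : ∀ z ∈ S, pairAlong e z ∈ ybDomain p q) (t : τ) :
    IsRegular S fun z => actAlong e (ybMap p q) z t := by
  obtain ⟨h1, h2⟩ := isRegular_ybMap (x := fun z => (pairAlong e z).1)
    (y := fun z => (pairAlong e z).2) (fun _ => isRegular_apply _) (fun _ => isRegular_apply _) hS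
  rcases h : e.symm t with (i | i) | k <;> simp only [actAlong, h, Sum.elim_inl, Sum.elim_inr]
  exacts [h1 i, h2 i, isRegular_apply _]

theorem isPrincipal_pairAlong_mem (hp : p ∈ admissible F) (hq : q ∈ admissible F) :
    IsPrincipal {z : τ → F | pairAlong e z ∈ ybDomain p q} := by
  have h := isPrincipal_ybDomain hp hq isPrincipal_univ (x := fun z => (pairAlong e z).1)
    (y := fun z => (pairAlong e z).2) (fun _ => isRegular_apply _) (fun _ => isRegular_apply _)
  simpa only [Set.mem_univ, true_and] using h

theorem isPrincipal_pullback (hp : p ∈ admissible F) (hq : q ∈ admissible F)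
    (hT : IsPrincipal T) : IsPrincipal (pullback e p q T) :=
  (isPrincipal_pairAlong_mem hp hq).preimage hT (isRegular_actAlong fun _ hz => hz)

theorem isRegular_pullback {f : (τ → F) → F} (hf : IsRegular T f) :
    IsRegular (pullback e p q T) fun z => f (actAlong e (ybMap p q) z) :=
  hf.comp (isRegular_actAlong fun _ hz => hz.1) fun _ hz => hz.2

theorem pullback_nonempty [Infinite F] (hp : p ∈ admissible F) (hq : q ∈ admissible F)
    (hT : IsPrincipal T) (hTne : T.Nonempty) : (pullback e p q T).Nonempty := by
  have hU : IsPrincipal {z : τ → F | (pairAlong e z).swap ∈ ybDomain q p} := by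
    have h := isPrincipal_ybDomain hq hp isPrincipal_univ (x := fun z => (pairAlong e z).2)
      (y := fun z => (pairAlong e z).1) (fun _ => isRegular_apply _) (fun _ => isRegular_apply _)
    simp only [Set.mem_univ, true_and] at h
    exact h
  obtain ⟨w, hw⟩ := ybDomain_nonempty hq hp
  obtain ⟨z, hz, hz'⟩ := hT.inter_nonempty hU hTne
    ⟨actAlong e (fun _ => w.swap) 0, by
      rwa [Set.mem_ofPred_eq, pairAlong_actAlong, Prod.swap_swap]⟩
  refine ⟨actAlong e (fun w => (ybMap q p w.swap).swap) z, ?_, ?_⟩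
  · rw [pairAlong_actAlong]
    exact ybMap_swap_mem_ybDomain hq hp hz'
  · rwa [actAlong_actAlong, actAlong_of_eq]
    exact ybMap_swap_ybMap hq hp hz'

end Pullback

section Triples

variable {F : Type*}

/-- The factors 1 and 2 of `F⁴ × F⁴ × F⁴`, for `actAlong`. -/
abbrev factors12 : (Fin 4 ⊕ Fin 4) ⊕ Fin 4 ≃ Fin 4 ⊕ Fin 4 ⊕ Fin 4 := Equiv.sumAssoc _ _ _

/-- The factors 1 and 3 of `F⁴ × F⁴ × F⁴`, for `actAlong`. -/
abbrev factors13 : (Fin 4 ⊕ Fin 4) ⊕ Fin 4 ≃ Fin 4 ⊕ Fin 4 ⊕ Fin 4 :=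
  (Equiv.sumAssoc _ _ _).trans (Equiv.sumCongr (Equiv.refl _) (Equiv.sumComm _ _))

/-- The factors 2 and 3 of `F⁴ × F⁴ × F⁴`, for `actAlong`. -/
abbrev factors23 : (Fin 4 ⊕ Fin 4) ⊕ Fin 4 ≃ Fin 4 ⊕ Fin 4 ⊕ Fin 4 := Equiv.sumComm _ _

/-- The three points of the phase space with the coordinates `z`. -/
def triple (z : Fin 4 ⊕ Fin 4 ⊕ Fin 4 → F) : Pt F × Pt F × Pt F :=
  (z ∘ Sum.inl, z ∘ Sum.inr ∘ Sum.inl, z ∘ Sum.inr ∘ Sum.inr)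

theorem triple_injective : Function.Injective (triple (F := F)) := fun z z' h => by
  simp only [triple, Prod.mk.injEq] at h
  ext (i | i | i)
  exacts [congrFun h.1 i, congrFun h.2.1 i, congrFun h.2.2 i]

theorem triple_actAlong_factors12 (R : Pt F × Pt F → Pt F × Pt F)
    (z : Fin 4 ⊕ Fin 4 ⊕ Fin 4 → F) :
    triple (actAlong factors12 R z) = act12 R (triple z) := rfl

theorem triple_actAlong_factors13 (R : Pt F × Pt F → Pt F × Pt F)
    (z : Fin 4 ⊕ Fin 4 ⊕ Fin 4 → F) :
    triple (actAlong factors13 R z) = act13 R (triple z) := rfl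

theorem triple_actAlong_factors23 (R : Pt F × Pt F → Pt F × Pt F)
    (z : Fin 4 ⊕ Fin 4 ⊕ Fin 4 → F) :
    triple (actAlong factors23 R z) = act23 R (triple z) := rfl

variable [Field F] {p q r : Params F}

/-- The points at which `R¹²_{p,q} ∘ R¹³_{p,r} ∘ R²³_{q,r}` is defined. -/
def leftDomain (p q r : Params F) : Set (Fin 4 ⊕ Fin 4 ⊕ Fin 4 → F) :=
  pullback factors23 q r (pullback factors13 p r (pullback factors12 p q Set.univ))

/-- The points at which `R²³_{q,r} ∘ R¹³_{p,r} ∘ R¹²_{p,q}` is defined. -/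
def rightDomain (p q r : Params F) : Set (Fin 4 ⊕ Fin 4 ⊕ Fin 4 → F) :=
  pullback factors12 p q (pullback factors13 p r (pullback factors23 q r Set.univ))

theorem triple_mem_tripleDomain_iff {z : Fin 4 ⊕ Fin 4 ⊕ Fin 4 → F} :
    triple z ∈ tripleDomain ybDomain ybMap p q r ↔ z ∈ leftDomain p q r ∩ rightDomain p q r := by
  constructor
  · rintro ⟨h1, h2, h3, h4, h5, h6⟩
    exact ⟨⟨h1, h2, h3, trivial⟩, h4, h5, h6, trivial⟩
  · rintro ⟨⟨h1, h2, h3, -⟩, h4, h5, h6, -⟩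
    exact ⟨h1, h2, h3, h4, h5, h6⟩

theorem isPrincipal_leftDomain (hp : p ∈ admissible F) (hq : q ∈ admissible F)
    (hr : r ∈ admissible F) : IsPrincipal (leftDomain p q r) :=
  isPrincipal_pullback hq hr (isPrincipal_pullback hp hr
    (isPrincipal_pullback hp hq isPrincipal_univ))

theorem isPrincipal_rightDomain (hp : p ∈ admissible F) (hq : q ∈ admissible F)
    (hr : r ∈ admissible F) : IsPrincipal (rightDomain p q r) :=
  isPrincipal_pullback hp hq (isPrincipal_pullback hp hr
    (isPrincipal_pullback hq hr isPrincipal_univ))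

theorem laxCol_ne_zero_of_apply_two_ne_zero {x : Pt F} (hx : x 2 ≠ 0) : laxCol p x ≠ 0 :=
  fun h => hx (congrFun h 0)

variable [Infinite F]

theorem generically_tripleDomain (hp : p ∈ admissible F) (hq : q ∈ admissible F)
    (hr : r ∈ admissible F) :
    Generically {z | triple z ∈ tripleDomain ybDomain ybMap p q r} := by
  have h12 := isPrincipal_pullback (e := factors12) hp hq isPrincipal_univ
  have h23 := isPrincipal_pullback (e := factors23) hq hr isPrincipal_univ
  have hleft : (leftDomain p q r).Nonempty :=
    pullback_nonempty hq hr (isPrincipal_pullback hp hr h12) (pullback_nonempty hp hr h12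
      (pullback_nonempty hp hq isPrincipal_univ Set.univ_nonempty))
  have hright : (rightDomain p q r).Nonempty :=
    pullback_nonempty hp hq (isPrincipal_pullback hp hr h23) (pullback_nonempty hp hr h23
      (pullback_nonempty hq hr isPrincipal_univ Set.univ_nonempty))
  have hL := isPrincipal_leftDomain hp hq hr
  have hR := isPrincipal_rightDomain hp hq hr
  simp only [triple_mem_tripleDomain_iff]
  exact (hL.inter hR).generically (hL.inter_nonempty hR hleft hright)

theorem yangBaxter (hp : p ∈ admissible F) (hq : q ∈ admissible F) (hr : r ∈ admissible F)
    {z : Fin 4 ⊕ Fin 4 ⊕ Fin 4 → F} (hz : triple z ∈ tripleDomain ybDomain ybMap p q r) :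
    act12 (ybMap p q) (act13 (ybMap p r) (act23 (ybMap q r) (triple z))) =
      act23 (ybMap q r) (act13 (ybMap p r) (act12 (ybMap p q) (triple z))) := by
  have hT : IsPrincipal {z : Fin 4 ⊕ Fin 4 ⊕ Fin 4 → F | z ∈ Set.univ ∧
      z (Sum.inl 2) * z (Sum.inr (Sum.inl 2)) * z (Sum.inr (Sum.inr 2)) ≠ 0} :=
    isPrincipal_univ.and_ne_zero (by fun_prop)
  have hleft : ∀ i, IsRegular (leftDomain p q r ∩ rightDomain p q r) fun z =>
      actAlong factors12 (ybMap p q) (actAlong factors13 (ybMap p r)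
        (actAlong factors23 (ybMap q r) z)) i := fun i =>
    (isRegular_pullback (isRegular_pullback (isRegular_pullback (isRegular_apply i)))).mono
      Set.inter_subset_left
  have hright : ∀ i, IsRegular (leftDomain p q r ∩ rightDomain p q r) fun z =>
      actAlong factors23 (ybMap q r) (actAlong factors13 (ybMap p r)
        (actAlong factors12 (ybMap p q) z)) i := fun i =>
    (isRegular_pullback (isRegular_pullback (isRegular_pullback (isRegular_apply i)))).mono
      Set.inter_subset_right
  refine congrArg triple (funext fun i => (hleft i).eqOn_of_inter
    ((isPrincipal_leftDomain hp hq hr).inter (isPrincipal_rightDomain hp hq hr)) hT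
    ⟨1, trivial, by simp⟩ (hright i) ?_ (triple_mem_tripleDomain_iff.1 hz))
  rintro z ⟨hz, -, hne⟩
  obtain ⟨⟨hx, hy⟩, hz₃⟩ := by simpa only [mul_ne_zero_iff] using hne
  refine congrFun (triple_injective ?_) i
  simp only [triple_actAlong_factors12, triple_actAlong_factors13, triple_actAlong_factors23]
  exact yangBaxter_of_laxCol_ne_zero hp hq hr (triple_mem_tripleDomain_iff.2 hz)
    (laxCol_ne_zero_of_apply_two_ne_zero hx) (laxCol_ne_zero_of_apply_two_ne_zero hy)
    (laxCol_ne_zero_of_apply_two_ne_zero hz₃)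

theorem isParametricYangBaxter_ybMap :
    IsParametricYangBaxter (admissible F) ybDomain ybMap := by
  intro p hp q hq r hr
  exact ⟨generically_tripleDomain hp hq hr, fun w hw =>
    yangBaxter hp hq hr (z := Sum.elim w.1 (Sum.elim w.2.1 w.2.2)) hw⟩

end Triples

/-! ### The exterior derivative of a one-form -/

section ExteriorDerivative

open ExteriorAlgebra KaehlerDifferential

section Ring

variable (R S : Type*) [CommRing R] [CommRing S] [Algebra R S]

/-- The exterior derivative on the free module whose basis vectors stand for the differentials of
the elements of `S`. -/
def extDerivTotal : (S →₀ S) →+ ExteriorAlgebra S Ω[S⁄R] :=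
  Finsupp.liftAddHom fun b =>
    (AddMonoidHom.mulRight (ι S (D R S b))).comp
      ((ι S).toAddMonoidHom.comp (D R S : S →ₗ[R] Ω[S⁄R]).toAddMonoidHom)

variable {R S}

theorem extDerivTotal_single (a b : S) :
    extDerivTotal R S (Finsupp.single b a) = ι S (D R S a) * ι S (D R S b) :=
  Finsupp.liftAddHom_apply_single _ b a

theorem extDerivTotal_eq_zero {t : S →₀ S} (ht : t ∈ kerTotal R S) : extDerivTotal R S t = 0 := by
  suffices ∀ c : S, extDerivTotal R S (c • t) = 0 by simpa using this 1
  induction ht using Submodule.span_induction with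
  | zero => simp
  | add s t _ _ hs ht => simp [hs, ht]
  | smul a t _ ht => exact fun c => by rw [smul_smul, ht]
  | mem t ht =>
    intro c
    obtain (⟨⟨a, b⟩, rfl⟩ | ⟨⟨a, b⟩, rfl⟩) | ⟨r, rfl⟩ := ht
    · simp [smul_sub, smul_add, extDerivTotal_single, mul_add]
    · have hab := ι_add_mul_swap (R := S) (D R S a) (D R S b)
      simp only [smul_sub, smul_add, Finsupp.smul_single, smul_eq_mul, mul_one, map_sub, map_add,
        extDerivTotal_single, Derivation.leibniz, map_smul, mul_add, add_mul, smul_mul_assoc,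
        mul_smul_comm]
      linear_combination (norm := module) c • hab
    · simp [extDerivTotal_single]

variable (R S) in
/-- The exterior derivative of Kähler differentials, `a db ↦ da ∧ db`. -/
def extDeriv : Ω[S⁄R] →+ ExteriorAlgebra S Ω[S⁄R] :=
  (Finsupp.linearCombination S (D R S)).toAddMonoidHom.liftOfSurjective
    (linearCombination_surjective R S)
    ⟨extDerivTotal R S, fun _ ht => extDerivTotal_eq_zero (kerTotal_eq R S ▸ ht)⟩

theorem extDeriv_smul_D (a b : S) :
    extDeriv R S (a • D R S b) = ι S (D R S a) * ι S (D R S b) := by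
  have h := AddMonoidHom.liftOfRightInverse_comp_apply
    (Finsupp.linearCombination S (D R S)).toAddMonoidHom _
    (Function.rightInverse_surjInv (linearCombination_surjective R S))
    ⟨extDerivTotal R S, fun _ ht => extDerivTotal_eq_zero (kerTotal_eq R S ▸ ht)⟩
    (Finsupp.single b a)
  rw [← extDerivTotal_single, ← Finsupp.linearCombination_single S a b]
  exact h

end Ring

theorem extDeriv_smul_inv_smul_D {F K : Type*} [Field F] [Field K] [Algebra F K] {c : K}
    (hc : D F K c = 0) (s : K) : extDeriv F K (c • s⁻¹ • D F K s) = 0 := by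
  rw [smul_smul, extDeriv_smul_D, Derivation.leibniz, hc, smul_zero, add_zero,
    Derivation.leibniz_inv]
  simp

end ExteriorDerivative

/-! ### Symplecticity -/

section OneForm

variable {F K M ι : Type*} [Field F] [Field K] [Algebra F K] [AddCommGroup M] [Module F M]
  [Module K M] (D : Derivation F K M)

/-- The tautological one-form `∑ k, cₖ drₖ` on pairs of a row `r` and a column `c`. -/
def tautForm [Fintype ι] (r c : ι → K) : M := ∑ k, c k • D (r k)

/-- The Liouville one-form `X₁ dx₁ + X₂ dx₂` of the phase space. -/
def liouville (x : Pt K) : M := x 2 • D (x 0) + x 3 • D (x 1)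

section TautForm

variable [Fintype ι] (r r' c c' : ι → K) (s : K)

theorem tautForm_sub_left : tautForm D (r - r') c = tautForm D r c - tautForm D r' c := by
  simp only [tautForm, Pi.sub_apply, map_sub, smul_sub, Finset.sum_sub_distrib]

theorem tautForm_smul_left : tautForm D (s • r) c = s • tautForm D r c + (r ⬝ᵥ c) • D s := by
  simp only [tautForm, dotProduct, Pi.smul_apply, smul_eq_mul, Derivation.leibniz, smul_add,
    Finset.sum_add_distrib, Finset.smul_sum, Finset.sum_smul]
  congr 1 <;> exact Finset.sum_congr rfl fun k _ => by module

theorem tautForm_add_right : tautForm D r (c + c') = tautForm D r c + tautForm D r c' := by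
  simp only [tautForm, Pi.add_apply, add_smul, Finset.sum_add_distrib]

theorem tautForm_smul_right : tautForm D r (s • c) = s • tautForm D r c := by
  simp only [tautForm, Pi.smul_apply, smul_eq_mul, mul_smul, Finset.smul_sum]

variable {s}

theorem tautForm_smul_inv_smul (hs : s ≠ 0) :
    tautForm D (s • r) (s⁻¹ • c) = tautForm D r c + (r ⬝ᵥ c) • s⁻¹ • D s := by
  rw [tautForm_smul_right, tautForm_smul_left, smul_add, inv_smul_smul₀ hs, smul_comm]

end TautForm

theorem RankOnePair.tautForm_refactor [Fintype ι] {P : RankOnePair K ι} (h : P.disc ≠ 0)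
    (hδ : D P.δ = 0) (hm : D P.m = 0) (hn : D P.n = 0) :
    tautForm D P.row P.col + tautForm D P.swap.row P.swap.col =
      tautForm D P.α P.a + tautForm D P.β P.b + (P.δ + P.n) • P.disc⁻¹ • D P.disc := by
  have hδ' : D P.δ' = 0 := by rw [δ', map_sub, map_add, hδ, hm, hn, add_zero, sub_zero]
  have hdisc : D P.disc = -(P.f • D P.g + P.g • D P.f) := by
    rw [disc, map_sub, Derivation.leibniz, Derivation.leibniz, hδ, hδ', smul_zero, smul_zero,
      add_zero, zero_sub]
  refine smul_right_injective _ h ?_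
  dsimp only
  rw [smul_add, smul_add, smul_comm P.disc (P.δ + P.n), smul_inv_smul₀ h, ← tautForm_smul_right,
    ← tautForm_smul_right, disc_smul_col h, disc_smul_swap_col h, swap_row, row, hdisc, disc]
  simp only [tautForm_sub_left, tautForm_smul_left, tautForm_add_right, tautForm_smul_right, hδ,
    hδ']
  simp only [δ', m, n, f, g]
  module

theorem tautForm_gauge {p : Params K} {W : Fin 3 → K} (hp : p ∈ admissible K) (hW : ∀ k, W k ≠ 0)
    (hDp : ∀ k, D (diagVec p k) = 0) (hDW : ∀ k, D (W k) = 0) (x : Pt K) :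
    tautForm D (gaugeRow p W x) (gaugeCol p W x) = -liouville D x := by
  have h0 : D p.a1 = 0 := hDp 0
  have h1 : D p.a2 = 0 := hDp 1
  obtain ⟨ha1, ha2, -⟩ := hp
  simp only [tautForm, liouville, Fin.sum_univ_three, gaugeRow, gaugeCol, laxRow, laxCol, diagVec,
    Pi.mul_apply, Pi.div_apply, cons_val, Derivation.leibniz, map_neg, hDW, h0, h1,
    Derivation.map_one_eq_zero, smul_zero, add_zero, smul_neg, smul_smul, neg_add]
  congr 3
  · have := hW 0
    field_simp
  · have := hW 1
    field_simp

end OneForm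

section Extension

variable {F K : Type*} [Field F] [Field K] (φ : F →+* K) (p : Params F)

theorem map_mem_admissible {p : Params F} (hp : p ∈ admissible F) : p.map φ ∈ admissible K :=
  ⟨(map_ne_zero φ).2 hp.1, (map_ne_zero φ).2 hp.2.1, (map_ne_zero φ).2 hp.2.2⟩

theorem diagVec_map (k : Fin 3) : diagVec (p.map φ) k = φ (diagVec p k) := by
  fin_cases k <;> rfl

theorem root1_map : root1 (p.map φ) = φ (root1 p) := by
  simp only [root1, Params.map, map_div₀, map_add, map_mul]

theorem root2_map : root2 (p.map φ) = φ (root2 p) := by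
  simp only [root2, Params.map, map_div₀, map_sub, map_mul, map_ofNat]

theorem gap_map : gap (p.map φ) = φ (gap p) := by
  simp only [gap, Params.map, map_div₀, map_neg, map_mul, map_ofNat]

end Extension

section Liouville

variable {F K M : Type*} [Field F] [Field K] [Algebra F K] [AddCommGroup M] [Module F M]
  [Module K M] (D : Derivation F K M)

theorem liouville_ybMap {p q : Params K} (hp : p ∈ admissible K) (hq : q ∈ admissible K)
    (hDp : ∀ k, D (diagVec p k) = 0) (hDq : ∀ k, D (diagVec q k) = 0) (hgp : D (gap p) = 0)
    (hgq : D (gap q) = 0) {x y : Pt K} (hδ : D (laxPair p q x y).δ = 0)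
    (hd : (x, y) ∈ ybDomain p q) :
    let P := laxPair p q x y
    let s := q.a3 / P.row 2
    let t := 1 / P.swap.row 2
    liouville D (ybMap p q (x, y)).1 + liouville D (ybMap p q (x, y)).2 +
        (gap p • s⁻¹ • D s + gap q • t⁻¹ • D t + (P.δ + gap q) • P.disc⁻¹ • D P.disc) =
      liouville D x + liouville D y := by
  intro P s t
  obtain ⟨hr, hr', hD, -, -⟩ := (mem_ybDomain_iff hp hq).1 hd
  have hs : s ≠ 0 := div_ne_zero hq.2.2 hr
  have ht : t ≠ 0 := one_div_ne_zero hr'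
  have hone : ∀ k : Fin 3, (1 : Fin 3 → K) k ≠ 0 := fun _ => one_ne_zero
  have hDone : ∀ k : Fin 3, D ((1 : Fin 3 → K) k) = 0 := fun _ => D.map_one_eq_zero
  have hu : tautForm D P.row P.col + gap p • s⁻¹ • D s = -liouville D (ybMap p q (x, y)).1 := by
    rw [← tautForm_gauge D hp (diagVec_ne_zero hq) hDp hDq, gaugeRow_ybMap_fst hp hq hd,
      gaugeCol_ybMap_fst hp hq hd, tautForm_smul_inv_smul D _ _ hs,
      RankOnePair.row_dotProduct_col hD, laxPair_m hp]
  have hv : tautForm D P.swap.row P.swap.col + gap q • t⁻¹ • D t =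
      -liouville D (ybMap p q (x, y)).2 := by
    rw [← tautForm_gauge D hq hone hDq hDone, gaugeRow_ybMap_snd hp hq hd,
      gaugeCol_ybMap_snd hp hq hd, tautForm_smul_inv_smul D _ _ ht,
      RankOnePair.swap_row_dotProduct_swap_col hD, laxPair_n hp hq]
  have hx : tautForm D P.α P.a = -liouville D x := tautForm_gauge D hp hone hDp hDone x
  have hy : tautForm D P.β P.b = -liouville D y :=
    tautForm_gauge D hq (diagVec_ne_zero hp) hDq hDp y
  have hn : P.n = gap q := laxPair_n hp hq x y
  have h := P.tautForm_refactor D hD hδ (laxPair_m hp x y ▸ hgp) (hn ▸ hgq)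
  rw [hx, hy, hn] at h
  linear_combination (norm := module) hu + hv - h

end Liouville

section FunctionField

open KaehlerDifferential

variable {F : Type*} [Field F]

theorem extDeriv_liouville (x : Pt (FunField F)) :
    extDeriv F (FunField F) (liouville (D F (FunField F)) x) =
      -(diff (x 0) * diff (x 2) + diff (x 1) * diff (x 3)) := by
  rw [liouville, map_add, extDeriv_smul_D, extDeriv_smul_D, neg_add]
  exact congrArg₂ _ (eq_neg_of_add_eq_zero_left (ExteriorAlgebra.ι_add_mul_swap _ _))
    (eq_neg_of_add_eq_zero_left (ExteriorAlgebra.ι_add_mul_swap _ _))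

theorem omega_eq_neg_extDeriv_liouville (w : Pt (FunField F) × Pt (FunField F)) :
    omega w = -extDeriv F (FunField F)
      (liouville (D F (FunField F)) w.1 + liouville (D F (FunField F)) w.2) := by
  rw [map_add, extDeriv_liouville, extDeriv_liouville, neg_add, neg_neg, neg_neg, omega, add_assoc]

theorem omega_ybMap {p q : Params (FunField F)} (hp : p ∈ admissible (FunField F))
    (hq : q ∈ admissible (FunField F)) (hDp : ∀ k, D F (FunField F) (diagVec p k) = 0)
    (hDq : ∀ k, D F (FunField F) (diagVec q k) = 0) (hgp : D F (FunField F) (gap p) = 0)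
    (hgq : D F (FunField F) (gap q) = 0) {x y : Pt (FunField F)}
    (hδ : D F (FunField F) (laxPair p q x y).δ = 0) (hd : (x, y) ∈ ybDomain p q) :
    omega (ybMap p q (x, y)) = omega (x, y) := by
  have hδq : D F (FunField F) ((laxPair p q x y).δ + gap q) = 0 := by
    rw [map_add, hδ, hgq, add_zero]
  rw [omega_eq_neg_extDeriv_liouville, omega_eq_neg_extDeriv_liouville,
    ← liouville_ybMap _ hp hq hDp hDq hgp hgq hδ hd]
  simp only [map_add, extDeriv_smul_inv_smul_D hgp, extDeriv_smul_inv_smul_D hgq,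
    extDeriv_smul_inv_smul_D hδq, add_zero]

/-- The pairs of a polynomial, as a rational function, and its value at `z`. -/
def evalGraph (z : Fin 4 ⊕ Fin 4 → F) : Subring (FunField F × F) :=
  ((algebraMap (MvPolynomial (Fin 4 ⊕ Fin 4) F) (FunField F)).prod (MvPolynomial.eval z)).range

variable {z : Fin 4 ⊕ Fin 4 → F}

theorem ne_zero_of_mk_mem_evalGraph {φ : FunField F} {c : F} (h : (φ, c) ∈ evalGraph z)
    (hc : c ≠ 0) : φ ≠ 0 := by
  obtain ⟨P, hP⟩ := h
  obtain ⟨rfl, rfl⟩ := Prod.mk.inj hP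
  exact fun h0 => hc (by
    rw [(map_eq_zero_iff _ (IsFractionRing.injective (MvPolynomial (Fin 4 ⊕ Fin 4) F) _)).1 h0]
    exact map_zero _)

theorem algebraMap_mk_mem_evalGraph (c : F) : (algebraMap F (FunField F) c, c) ∈ evalGraph z :=
  ⟨MvPolynomial.C c, Prod.ext (IsScalarTower.algebraMap_apply F (MvPolynomial _ F) _ c).symm
    (MvPolynomial.eval_C c)⟩

theorem div_algebraMap_mk_mem_evalGraph {φ : FunField F} {c : F} (h : (φ, c) ∈ evalGraph z)
    (d : F) : (φ / algebraMap F (FunField F) d, c / d) ∈ evalGraph z := by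
  rw [div_eq_mul_inv, div_eq_mul_inv, ← map_inv₀]
  exact mul_mem h (algebraMap_mk_mem_evalGraph d⁻¹)

theorem genericPt_fst_mk_mem_evalGraph (i : Fin 4) :
    ((genericPt F).1 i, z (Sum.inl i)) ∈ evalGraph z :=
  ⟨MvPolynomial.X (Sum.inl i), Prod.ext rfl (MvPolynomial.eval_X _)⟩

theorem genericPt_snd_mk_mem_evalGraph (i : Fin 4) :
    ((genericPt F).2 i, z (Sum.inr i)) ∈ evalGraph z :=
  ⟨MvPolynomial.X (Sum.inr i), Prod.ext rfl (MvPolynomial.eval_X _)⟩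

theorem laxPair_f_mk_mem_evalGraph {p : Params F} (q : Params F) (hp : p ∈ admissible F)
    {x y : Pt F} {x' y' : Pt (FunField F)} (hx : ∀ i, (x' i, x i) ∈ evalGraph z)
    (hy : ∀ i, (y' i, y i) ∈ evalGraph z) :
    ((laxPair (p.map (algebraMap F (FunField F))) (q.map (algebraMap F (FunField F))) x' y').f,
      (laxPair p q x y).f) ∈ evalGraph z := by
  have hc := algebraMap_mk_mem_evalGraph (z := z)
  rw [laxPair_f (map_mem_admissible _ hp), laxPair_f hp, gap_map]
  exact add_mem (add_mem (mul_mem (sub_mem (mul_mem (hc _) (hx 0)) (mul_mem (hc _) (hy 0))) (hx 2))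
    (mul_mem (sub_mem (mul_mem (hc _) (hx 1)) (mul_mem (hc _) (hy 1))) (hx 3)))
    (mul_mem (hc _) (hc _))

theorem laxPair_g_mk_mem_evalGraph {p q : Params F} (hp : p ∈ admissible F)
    (hq : q ∈ admissible F) {x y : Pt F} {x' y' : Pt (FunField F)}
    (hx : ∀ i, (x' i, x i) ∈ evalGraph z) (hy : ∀ i, (y' i, y i) ∈ evalGraph z) :
    ((laxPair (p.map (algebraMap F (FunField F))) (q.map (algebraMap F (FunField F))) x' y').g,
      (laxPair p q x y).g) ∈ evalGraph z := by
  have hc := algebraMap_mk_mem_evalGraph (z := z)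
  have hdiv {φ c} := div_algebraMap_mk_mem_evalGraph (z := z) (φ := φ) (c := c)
  rw [laxPair_g (map_mem_admissible _ hp) (map_mem_admissible _ hq), laxPair_g hp hq, gap_map]
  simp only [div_mul_eq_div_div]
  exact sub_mem (sub_mem (hdiv (hc _) _) (hdiv (hdiv (mul_mem (sub_mem (mul_mem (hc _) (hx 0))
    (mul_mem (hc _) (hy 0))) (hy 2)) _) _)) (hdiv (hdiv (mul_mem (sub_mem (mul_mem (hc _) (hx 1))
    (mul_mem (hc _) (hy 1))) (hy 3)) _) _)

theorem genericPt_mem_ybDomain [Infinite F] {p q : Params F} (hp : p ∈ admissible F)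
    (hq : q ∈ admissible F) :
    genericPt F ∈ ybDomain (p.map (algebraMap F (FunField F)))
      (q.map (algebraMap F (FunField F))) := by
  obtain ⟨⟨x, y⟩, hxy⟩ := ybDomain_nonempty hp hq
  obtain ⟨hr, hs, hD, h0, h1⟩ := (mem_ybDomain_iff hp hq).1 hxy
  have hp' := map_mem_admissible (algebraMap F (FunField F)) hp
  have hq' := map_mem_admissible (algebraMap F (FunField F)) hq
  have hc := algebraMap_mk_mem_evalGraph (z := Sum.elim x y)
  have hx := genericPt_fst_mk_mem_evalGraph (z := Sum.elim x y)
  have hy := genericPt_snd_mk_mem_evalGraph (z := Sum.elim x y)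
  have hf := laxPair_f_mk_mem_evalGraph q hp hx hy
  have hg := laxPair_g_mk_mem_evalGraph hp hq hx hy
  have hδ := hc (laxPair p q x y).δ
  have hδ' := hc (laxPair p q x y).δ'
  rw [laxPair, map_sub, ← root1_map, ← root1_map] at hδ
  rw [laxPair_δ' hp hq, map_sub, ← root2_map, ← root2_map, ← laxPair_δ' hp' hq' (genericPt F).1
    (genericPt F).2, ← laxPair_δ' hp hq x y] at hδ'
  refine (mem_ybDomain_iff hp' hq').2 ⟨?_, ?_, ne_zero_of_mk_mem_evalGraph
      (sub_mem (mul_mem hδ hδ') (mul_mem hf hg)) hD,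
    ne_zero_of_mk_mem_evalGraph (sub_mem (mul_mem (hc _) (hx 0)) (mul_mem (hc _) (hy 0))) h0,
    ne_zero_of_mk_mem_evalGraph (sub_mem (mul_mem (hc _) (hx 1)) (mul_mem (hc _) (hy 1))) h1⟩
  · rw [laxPair_row] at hr ⊢
    exact ne_zero_of_mk_mem_evalGraph (sub_mem hδ' (mul_mem (hc _) hg)) hr
  · rw [laxPair_swap_row] at hs ⊢
    exact ne_zero_of_mk_mem_evalGraph (sub_mem (mul_mem (hc _) hδ) hf) hs

theorem isSymplectic [Infinite F] {p q : Params F} (hp : p ∈ admissible F)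
    (hq : q ∈ admissible F) : IsSymplectic p q := by
  have hD : ∀ c : F, D F (FunField F) (algebraMap F (FunField F) c) = 0 :=
    (D F (FunField F)).map_algebraMap
  refine ⟨genericPt_mem_ybDomain hp hq, omega_ybMap (map_mem_admissible _ hp)
    (map_mem_admissible _ hq) (fun k => ?_) (fun k => ?_) ?_ ?_ ?_ (genericPt_mem_ybDomain hp hq)⟩
  · rw [diagVec_map, hD]
  · rw [diagVec_map, hD]
  · rw [gap_map, hD]
  · rw [gap_map, hD]
  · rw [laxPair, root1_map, root1_map, map_sub, hD, hD, sub_zero]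

end FunctionField

end YangBaxter

end

theorem proposition2_general {F : Type*} [Field F] [Infinite F] (h3 : (3 : F) ≠ 0) :
    YangBaxter.IsParametricYangBaxter (YangBaxter.admissible F)
      YangBaxter.ybDomain YangBaxter.ybMap ∧
    (∀ p ∈ YangBaxter.admissible F, ∀ q ∈ YangBaxter.admissible F,
      YangBaxter.IsBirationalPair (YangBaxter.ybDomain p q) (YangBaxter.ybMap p q)) ∧
    (∀ p ∈ YangBaxter.admissible F, ∀ q ∈ YangBaxter.admissible F,
      YangBaxter.DisjointSpectra p q →
        YangBaxter.IsQuadrirational (YangBaxter.ybDomain p q) (YangBaxter.ybMap p q)) ∧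
    (∀ p ∈ YangBaxter.admissible F, ∀ q ∈ YangBaxter.admissible F,
      YangBaxter.IsStrongLax p q) ∧
    (∀ p ∈ YangBaxter.admissible F, ∀ q ∈ YangBaxter.admissible F,
      YangBaxter.IsSymplectic p q) :=
  ⟨YangBaxter.isParametricYangBaxter_ybMap,
    fun _ hp _ hq => YangBaxter.isBirationalPair_ybMap hp hq,
    fun _ hp _ hq hs => YangBaxter.isQuadrirational_ybMap hp hq hs,
    fun _ hp _ hq => YangBaxter.isStrongLax_of_admissible h3 hp hq,
    fun _ hp _ hq => YangBaxter.isSymplectic hp hq⟩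

theorem proposition2 {F : Type*} [Field F] [CharZero F] :
    YangBaxter.IsParametricYangBaxter (YangBaxter.admissible F)
      YangBaxter.ybDomain YangBaxter.ybMap ∧
    (∀ p ∈ YangBaxter.admissible F, ∀ q ∈ YangBaxter.admissible F,
      YangBaxter.IsBirationalPair (YangBaxter.ybDomain p q) (YangBaxter.ybMap p q)) ∧
    (∀ p ∈ YangBaxter.admissible F, ∀ q ∈ YangBaxter.admissible F,
      YangBaxter.DisjointSpectra p q →
        YangBaxter.IsQuadrirational (YangBaxter.ybDomain p q) (YangBaxter.ybMap p q)) ∧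
    (∀ p ∈ YangBaxter.admissible F, ∀ q ∈ YangBaxter.admissible F,
      YangBaxter.IsStrongLax p q) ∧
    (∀ p ∈ YangBaxter.admissible F, ∀ q ∈ YangBaxter.admissible F,
      YangBaxter.IsSymplectic p q) :=
  proposition2_general three_ne_zero
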